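/- Let $n\ge 0$, $0\le k\le n$ and $\rho\in[0,1]$. Let $\mu$ be the uniform distribution on $\{\pm1\}^n$, let $f:\{\pm1\}^n\to\{0,1\}$ be any Boolean function with support $A=f^{-1}(1)$, and let $T_\rho f(x)=\mathbb E[f(Y)\mid X=x]$, where $X\sim\mu$ and $Y$ is obtained from $X$ by independently changing the sign of each coordinate with probability $\frac{1-\rho}{2}$. For $S\subseteq[n]$ with $|S|=k$ and $a\in\{\pm1\}^S$ put $p_{S\mapsto a}(f)=\mu(A\cap\{x: x_S=a\})$ and $\vec p_S(f)=(p_{S\mapsto a}(f))_{a}$, so that $2^k p_{S\mapsto a}(f)$ is the mean of the restriction of $f$ to the subcube $\{x_S=a\}$. For $\alpha\in(0,1)$ and $\beta\in(0,1)$ let $s,\hat s,t,\hat t> 0$ be given by $\alpha=e^{-s^2/2}=1-e^{-\hat s^2/2}$ and $\beta=e^{-t^2/2}=1-e^{-\hat t^2/2}$, and define $\theta_\alpha(\beta)$ (up to finitely many $\beta$) by $$\theta_\alpha(\beta)=\begin{cases} \frac{t-\rho s}{(1-\rho^2)t}\,e^{\frac{t^2}{2}-\frac{s^2+t^2-2\rho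 st}{2(1-\rho^2)}}, & \rho s\le t\le s/\rho \text{ and } \big[(\rho\hat s\le\hat t\le\hat s/\rho,\ t\ge\hat s)\text{ or }\hat t\le\rho\hat s\text{ or }\hat t\ge\hat s/\rho\big],\\ 1-\frac{\hat t-\rho\hat s}{(1-\rho^2)\hat t}\,e^{\frac{\hat t^2}{2}-\frac{\hat s^2+\hat t^2-2\rho\hat s\hat t}{2(1-\rho^2)}}, & \rho\hat s\le\hat t\le\hat s/\rho \text{ and } \big[(\rho s\le t\le s/\rho,\ t\le\hat s)\text{ or }t\le\rho s\text{ or }t\ge s/\rho\big],\\ 0, & t\le\rho s \text{ and } \hat t\ge\hat s/\rho,\\ 1, & t\ge s/\rho \text{ and } \hat t\le\rho\hat s, \end{cases}$$ where $s/\rho=\hat s/\rho=+\infty$ if $\rho=0$; put $\theta_0\equiv0$ and $\theta_1\equiv1$. For $\vec\epsilon=(\epsilon_a)_{a\in\{\pm1\}^k}\in[0,1]^{2^k}$ define $$\Gamma(\vec\epsilon)=2^{-k}\sum_{a\in\{\pm1\}^k}\int_0^1\Phi\Big(\sum_{b\in\{\pm1\}^k}\big(\tfrac{1+\rho}{2}\big)^{k-\frac{|b-a|}{2}}\big(\tfrac{1-\rho}{2}\big)^{\frac{|b-a|}{2}}\theta_{\epsilon_b}(\beta)\Big)\,d\beta,$$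 where $\frac{|b-a|}{2}$ is the number of coordinates in which $a$ and $b$ differ. Theorem. For every continuous convex function $\Phi:[0,1]\to\mathbb R$ and every Boolean function $f$ as above, $$\mathbb E_\mu[\Phi(T_\rho f)]\le\min_{S\subseteq[n]:\,|S|=k}\Gamma\big(2^k\,\vec p_S(f)\big).$$ -/

import Mathlib

namespace NoiseStability

noncomputable section

/-- The discrete cube `{±1}^ι`. -/
abbrev Cube (ι : Type) : Type := ι → ℤˣ

/-- Expectation under the uniform distribution on `{±1}^n`. -/
def mean {n : ℕ} (g : Cube (Fin n) → ℝ) : ℝ :=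
  (∑ x, g x) / 2 ^ n

/-- `f` takes only the values `0` and `1`. -/
def IsBoolean {n : ℕ} (f : Cube (Fin n) → ℝ) : Prop :=
  ∀ x, f x = 0 ∨ f x = 1

/-- The conditional probability that `Y = y` given `X = x`, where `Y` is obtained from `x` by
independently flipping the sign of each coordinate with probability `(1 - ρ) / 2`. -/
def noiseKernel (ρ : ℝ) {n : ℕ} (x y : Cube (Fin n)) : ℝ :=
  ∏ i, if y i = x i then (1 + ρ) / 2 else (1 - ρ) / 2

/-- The Bonami-Beckner operator `T_ρ f (x) = E[f(Y) | X = x]`. -/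
def noiseOp (ρ : ℝ) {n : ℕ} (f : Cube (Fin n) → ℝ) (x : Cube (Fin n)) : ℝ :=
  ∑ y, noiseKernel ρ x y * f y

open Classical in
/-- `p_{S ↦ a}(f) = μ(f · 1{x_S = a})`. -/
def subcubeMass {n : ℕ} (f : Cube (Fin n) → ℝ) (S : Finset (Fin n)) (a : Cube S) : ℝ :=
  mean fun x => if ∀ i : S, x i = a i then f x else 0

/-- The number `s ≥ 0` with `α = exp (-s² / 2)`, for `α ∈ (0, 1]`. -/
def level (α : ℝ) : ℝ := Real.sqrt (-2 * Real.log α)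

/-- `∂/∂β` of `exp (-(s² + t² - 2ρst) / (2(1 - ρ²)))`, where `β = exp (-t² / 2)`. -/
def branch (ρ s t : ℝ) : ℝ :=
  (t - ρ * s) / ((1 - ρ ^ 2) * t) *
    Real.exp (t ^ 2 / 2 - (s ^ 2 + t ^ 2 - 2 * ρ * s * t) / (2 * (1 - ρ ^ 2)))

/-- The interior branches of `θ`, in terms of `s, ŝ, t, t̂` with `α = exp (-s² / 2)`,
`1 - α = exp (-ŝ² / 2)`, `β = exp (-t² / 2)`, `1 - β = exp (-t̂² / 2)`. The condition
`t ≤ s / ρ` is written `ρ * t ≤ s`, which is also right for `ρ = 0`. -/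
def thetaAux (ρ s s' t t' : ℝ) : ℝ :=
  open Classical in
  if (ρ * s ≤ t ∧ ρ * t ≤ s) ∧
      ((ρ * s' ≤ t' ∧ ρ * t' ≤ s' ∧ s' ≤ t) ∨ t' ≤ ρ * s' ∨ s' ≤ ρ * t') then
    branch ρ s t
  else if (ρ * s' ≤ t' ∧ ρ * t' ≤ s') ∧
      ((ρ * s ≤ t ∧ ρ * t ≤ s ∧ t ≤ s') ∨ t ≤ ρ * s ∨ s ≤ ρ * t) then
    1 - branch ρ s' t'
  else if t ≤ ρ * s ∧ s' ≤ ρ * t' then 0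
  else 1

/-- `θ_α(β)`, the derivative in `β` of the small-set-expansion bound `Θ(α, β)` on the noise
stability of sets of measures `α` and `β`, for `α ∈ [0, 1]` and `β ∈ (0, 1)`. For `α = 0` one has
`s = ∞`, and for `α = 1` one has `ŝ = ∞`; then `Θ(0, β) = 0` and `Θ(1, β) = β`. -/
def theta (ρ α β : ℝ) : ℝ :=
  open Classical in
  if α ≤ 0 then 0
  else if 1 ≤ α then 1
  else thetaAux ρ (level α) (level (1 - α)) (level β) (level (1 - β))

/-- The function `Γ` of a vector `ε = (ε_b)` indexed by `b ∈ {±1}^ι`; here `k = |ι|`, and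
`hammingDist b a` is the number `|b - a| / 2` of coordinates in which `a` and `b` differ. -/
def Gamma (Φ : ℝ → ℝ) (ρ : ℝ) {ι : Type} [Fintype ι] [DecidableEq ι] (ε : Cube ι → ℝ) : ℝ :=
  (∑ a : Cube ι, ∫ β in (0 : ℝ)..1,
    Φ (∑ b : Cube ι, ((1 + ρ) / 2) ^ (Fintype.card ι - hammingDist b a) *
      ((1 - ρ) / 2) ^ hammingDist b a * theta ρ (ε b) β)) / 2 ^ Fintype.card ι

end

end NoiseStability

/-!
The kernel of `T_ρ` is a product, so on the subcube `{x_S = a}` the function `T_ρ f` is an average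
over `b`, with the weights occurring in `Γ`, of the functions `T_ρ f_b`, where `f_b` is the
restriction of `f` to `{x_S = b}` and `T_ρ` now acts on the coordinates outside `S`. It therefore
suffices to show that each `T_ρ f_b` is majorized by `θ_α` for `α = 𝔼 f_b`: majorization survives
nonnegative combinations, and the Hardy-Littlewood-Pólya inequality applies to the result.

Majorization by `θ_α` bounds `𝔼 (1_B · T_ρ f_b)` by the integral of `θ_α` over `[0, β]`, where `β`
is the measure of `B`. This is small-set expansion: by the two-function form of hypercontractivity
with optimal exponents, `𝔼 (g · T_ρ f)` is at most `exp (-(s² + t² - 2ρst) / (2(1 - ρ²)))`,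
and the same bound applied to `1 - f` and `1 - g` is better when `α + β > 1`; `θ_α` is the
derivative in `β` of the better one. Hypercontractivity itself tensorizes, and for a single bit it
is a two-point inequality.
-/

namespace NoiseStability

noncomputable section


open Real Set Matrix MeasureTheory
open scoped BigOperators Matrix Kronecker

/-- The `p`-th moment of the function `x ↦ 1 + a x` on the two-point space `{±1}` with its uniform
probability measure. -/
def twoPointMoment (p a : ℝ) : ℝ := ((1 + a) ^ p + (1 - a) ^ p) / 2

/-- The odd counterpart of `twoPointMoment`: up to constants, each is the derivative of the
other. -/
def twoPointSkewMoment (p a : ℝ) : ℝ := ((1 + a) ^ p - (1 - a) ^ p) / 2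

lemma twoPointMoment_neg (p a : ℝ) : twoPointMoment p (-a) = twoPointMoment p a := by
  simp only [twoPointMoment]; ring_nf

lemma twoPointMoment_abs (p a : ℝ) : twoPointMoment p |a| = twoPointMoment p a := by
  rcases abs_choice a with h | h <;> rw [h]
  exact twoPointMoment_neg p a

lemma twoPointMoment_zero (p : ℝ) : twoPointMoment p 0 = 1 := by simp [twoPointMoment]

lemma twoPointMoment_two (a : ℝ) : twoPointMoment 2 a = 1 + a ^ 2 := by
  simp only [twoPointMoment, rpow_two]; ring

lemma twoPointMoment_pos {p a : ℝ} (ha : |a| ≤ 1) : 0 < twoPointMoment p a := by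
  rw [← twoPointMoment_abs]
  have h₁ : 0 < (1 + |a|) ^ p := rpow_pos_of_pos (by positivity) p
  have h₂ : 0 ≤ (1 - |a|) ^ p := rpow_nonneg (by linarith) p
  unfold twoPointMoment
  linarith

lemma continuous_twoPointMoment {p : ℝ} (hp : 0 ≤ p) : Continuous (twoPointMoment p) := by
  unfold twoPointMoment
  fun_prop (disch := exact fun _ => Or.inr hp)

lemma hasDerivAt_one_add_rpow (p : ℝ) {x : ℝ} (hx : -1 < x) :
    HasDerivAt (fun x => (1 + x) ^ p) (p * (1 + x) ^ (p - 1)) x := by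
  simpa using ((hasDerivAt_id x).const_add 1).rpow_const (p := p)
    (Or.inl (by simp only [id]; linarith))

lemma hasDerivAt_one_sub_rpow (p : ℝ) {x : ℝ} (hx : x < 1) :
    HasDerivAt (fun x => (1 - x) ^ p) (-(p * (1 - x) ^ (p - 1))) x := by
  simpa using ((hasDerivAt_id x).const_sub 1).rpow_const (p := p)
    (Or.inl (by simp only [id]; linarith))

lemma hasDerivAt_twoPointMoment (p : ℝ) {x : ℝ} (hx : x ∈ Ioo (-1) 1) :
    HasDerivAt (twoPointMoment p) (p * twoPointSkewMoment (p - 1) x) x := by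
  refine (((hasDerivAt_one_add_rpow p hx.1).add (hasDerivAt_one_sub_rpow p hx.2)).div_const
    2).congr_deriv ?_
  unfold twoPointSkewMoment
  ring

lemma hasDerivAt_twoPointSkewMoment (p : ℝ) {x : ℝ} (hx : x ∈ Ioo (-1) 1) :
    HasDerivAt (twoPointSkewMoment p) (p * twoPointMoment (p - 1) x) x := by
  refine (((hasDerivAt_one_add_rpow p hx.1).sub (hasDerivAt_one_sub_rpow p hx.2)).div_const
    2).congr_deriv ?_
  unfold twoPointMoment
  ring

lemma twoPointMoment_eq_mul_cosh (p : ℝ) {x : ℝ} (hx : x ∈ Ioo (-1) 1) :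
    twoPointMoment p x = (1 - x ^ 2) ^ (p / 2) * cosh (p * artanh x) := by
  have h₁ : 0 < 1 + x := by linarith [hx.1]
  have h₂ : 0 < 1 - x := by linarith [hx.2]
  rw [twoPointMoment, cosh_eq, show 1 - x ^ 2 = (1 + x) * (1 - x) by ring,
    artanh_eq_half_log (Ioo_subset_Icc_self hx), log_div h₁.ne' h₂.ne',
    rpow_def_of_pos h₁, rpow_def_of_pos h₂, rpow_def_of_pos (mul_pos h₁ h₂),
    log_mul h₁.ne' h₂.ne', mul_div_assoc', mul_add, ← exp_add, ← exp_add]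
  ring_nf

lemma twoPointMoment_le_of_nonpos {p r x y : ℝ} (hpr : p ≤ r) (hr : r ≤ 0) (hyx : |y| ≤ |x|)
    (hx : |x| < 1) : twoPointMoment r y ≤ twoPointMoment p x := by
  rw [← twoPointMoment_abs r, ← twoPointMoment_abs p]
  have hx' : |x| ∈ Ioo (-1 : ℝ) 1 := ⟨by linarith [abs_nonneg x], hx⟩
  have hy' : |y| ∈ Ioo (-1 : ℝ) 1 := ⟨by linarith [abs_nonneg y], hyx.trans_lt hx⟩
  have hx₀ : 0 < 1 - |x| ^ 2 := by nlinarith [abs_nonneg x]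
  have hsq : 1 - |x| ^ 2 ≤ 1 - |y| ^ 2 := by gcongr
  have hx₁ : 1 - |x| ^ 2 ≤ 1 := by linarith [sq_nonneg |x|]
  rw [twoPointMoment_eq_mul_cosh r hy', twoPointMoment_eq_mul_cosh p hx']
  have hpow : (1 - |y| ^ 2) ^ (r / 2) ≤ (1 - |x| ^ 2) ^ (p / 2) :=
    (rpow_le_rpow_of_nonpos hx₀ hsq (by linarith)).trans
      (rpow_le_rpow_of_exponent_ge hx₀ hx₁ (by linarith))
  have hcosh : cosh (r * artanh |y|) ≤ cosh (p * artanh |x|) := by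
    rw [cosh_le_cosh, abs_mul, abs_mul, abs_of_nonneg (artanh_nonneg (abs_nonneg y)),
      abs_of_nonneg (artanh_nonneg (abs_nonneg x)), abs_of_nonpos hr, abs_of_nonpos (hpr.trans hr)]
    have := (artanh_le_artanh_iff hy' hx').2 hyx
    have := artanh_nonneg (abs_nonneg y)
    gcongr
    linarith
  have := (cosh_pos (r * artanh |y|)).le
  gcongr

/-- The exponents are tuned so that the second derivative is
`p (p - 1) (twoPointMoment (p - 2) x - twoPointMoment (r - 2) (ρ x))`. -/
lemma convexOn_twoPointMoment_sub {p r ρ : ℝ} (hp : 1 < p) (hpr : p ≤ r) (hr : r ≤ 2)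
    (hρ₀ : 0 ≤ ρ) (hρ₁ : ρ ≤ 1) (hρ : ρ ^ 2 * (r - 1) = p - 1) :
    ConvexOn ℝ (Icc (-1) 1)
      (fun x => twoPointMoment p x - p / r * twoPointMoment r (ρ * x)) := by
  have hmul {x : ℝ} (hx : x ∈ Ioo (-1 : ℝ) 1) : ρ * x ∈ Ioo (-1 : ℝ) 1 := by
    constructor <;> nlinarith [hx.1, hx.2]
  have hcont := (continuous_twoPointMoment (p := p) (by linarith)).sub
    (((continuous_twoPointMoment (p := r) (by linarith)).comp
      (continuous_const_mul ρ)).const_mul (p / r))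
  refine convexOn_of_hasDerivWithinAt2_nonneg (convex_Icc _ _) hcont.continuousOn
    (f' := fun x => p * (twoPointSkewMoment (p - 1) x - ρ * twoPointSkewMoment (r - 1) (ρ * x)))
    (f'' := fun x => p * (p - 1) * (twoPointMoment (p - 2) x - twoPointMoment (r - 2) (ρ * x)))
    ?_ ?_ ?_ <;> rw [interior_Icc] <;> intro x hx
  · refine (((hasDerivAt_twoPointMoment p hx).sub (((hasDerivAt_twoPointMoment r
      (hmul hx)).comp x (hasDerivAt_const_mul ρ)).const_mul (p / r))).congr_deriv
      ?_).hasDerivWithinAt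
    field [show r ≠ 0 by linarith]
  · refine ((((hasDerivAt_twoPointSkewMoment (p - 1) hx).sub (((hasDerivAt_twoPointSkewMoment
      (r - 1) (hmul hx)).comp x (hasDerivAt_const_mul ρ)).const_mul ρ)).const_mul p).congr_deriv
      ?_).hasDerivWithinAt
    rw [show p - 1 - 1 = p - 2 by ring, show r - 1 - 1 = r - 2 by ring]
    linear_combination (-(p * twoPointMoment (r - 2) (ρ * x))) * hρ
  · have habs : |ρ * x| ≤ |x| := by
      rw [abs_mul, abs_of_nonneg hρ₀]
      exact mul_le_of_le_one_left (abs_nonneg x) hρ₁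
    have := twoPointMoment_le_of_nonpos (p := p - 2) (r := r - 2) (by linarith) (by linarith)
      habs (abs_lt.2 hx)
    exact mul_nonneg (mul_nonneg (by linarith) (by linarith)) (by linarith)

lemma one_add_mul_twoPointMoment_sub_one_le {p r ρ a : ℝ} (hp : 1 < p) (hpr : p ≤ r) (hr : r ≤ 2)
    (hρ₀ : 0 ≤ ρ) (hρ₁ : ρ ≤ 1) (hρ : ρ ^ 2 * (r - 1) = p - 1) (ha : |a| ≤ 1) :
    1 + p / r * (twoPointMoment r (ρ * a) - 1) ≤ twoPointMoment p a := by
  have hconv := (convexOn_twoPointMoment_sub hp hpr hr hρ₀ hρ₁ hρ).2 (abs_le.1 ha)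
    (abs_le.1 ((abs_neg a).trans_le ha)) one_half_pos.le one_half_pos.le (add_halves 1)
  simp only [smul_eq_mul, mul_neg, add_neg_cancel, twoPointMoment_neg, mul_zero,
    twoPointMoment_zero] at hconv
  linarith

lemma twoPointMoment_rpow_one_div_le {p r ρ a : ℝ} (hp : 1 < p) (hpr : p ≤ r) (hr : r ≤ 2)
    (hρ₀ : 0 ≤ ρ) (hρ₁ : ρ ≤ 1) (hρ : ρ ^ 2 * (r - 1) = p - 1) (ha : |a| ≤ 1) :
    twoPointMoment r (ρ * a) ^ (1 / r) ≤ twoPointMoment p a ^ (1 / p) := by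
  have hp₀ : 0 < p := by linarith
  have hr₀ : 0 < r := by linarith
  have hρa : |ρ * a| ≤ 1 := by
    rw [abs_mul, abs_of_nonneg hρ₀]
    exact mul_le_one₀ hρ₁ (abs_nonneg a) ha
  have hpos : 0 < twoPointMoment r (ρ * a) := twoPointMoment_pos hρa
  have bernoulli : twoPointMoment r (ρ * a) ^ (p / r) ≤
      1 + p / r * (twoPointMoment r (ρ * a) - 1) := by
    simpa using rpow_one_add_le_one_add_mul_self (s := twoPointMoment r (ρ * a) - 1)
      (by linarith) (div_nonneg hp₀.le hr₀.le) ((div_le_one hr₀).2 hpr)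
  calc twoPointMoment r (ρ * a) ^ (1 / r)
      = (twoPointMoment r (ρ * a) ^ (p / r)) ^ (1 / p) := by
        rw [← rpow_mul hpos.le]; congr 1; field
    _ ≤ twoPointMoment p a ^ (1 / p) := by
        gcongr
        exact bernoulli.trans (one_add_mul_twoPointMoment_sub_one_le hp hpr hr hρ₀ hρ₁ hρ ha)

lemma one_add_mul_le_twoPointMoment_mul {r q a b : ℝ} (hrq : r.HolderConjugate q) (ha : |a| ≤ 1)
    (hb : |b| ≤ 1) :
    1 + a * b ≤ twoPointMoment r a ^ (1 / r) * twoPointMoment q b ^ (1 / q) := by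
  have hsum (s : ℝ) {x : ℝ} (hx : |x| ≤ 1) : ((1 + x) ^ s + (1 - x) ^ s) ^ (1 / s) =
      (2 : ℝ) ^ (1 / s) * twoPointMoment s x ^ (1 / s) := by
    rw [← mul_rpow zero_le_two (twoPointMoment_pos hx).le, twoPointMoment,
      mul_div_cancel₀ _ two_ne_zero]
  have hnonneg {x : ℝ} (hx : |x| ≤ 1) (i : Fin 2) : 0 ≤ ![1 + x, 1 - x] i := by
    fin_cases i <;> simp <;> linarith [abs_le.1 hx]
  have holder := inner_le_Lp_mul_Lq_of_nonneg (Finset.univ : Finset (Fin 2)) hrq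
    (fun i _ => hnonneg ha i) (fun i _ => hnonneg hb i)
  simp only [Fin.sum_univ_two, Matrix.cons_val_zero, Matrix.cons_val_one] at holder
  have hone : 1 / r + 1 / q = 1 := by simpa using hrq.inv_add_inv_eq_one
  rw [hsum r ha, hsum q hb, mul_mul_mul_comm, ← rpow_add two_pos, hone, rpow_one] at holder
  linarith

lemma one_add_mul_le_of_two_le {p q ρ a b : ℝ} (hp : 1 < p) (hq : 2 ≤ q) (hρ₀ : 0 ≤ ρ)
    (hρ₁ : ρ ≤ 1) (hρ : (p - 1) * (q - 1) = ρ ^ 2) (ha : |a| ≤ 1) (hb : |b| ≤ 1) :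
    1 + ρ * a * b ≤ twoPointMoment p a ^ (1 / p) * twoPointMoment q b ^ (1 / q) := by
  have hq₁ : 0 < q - 1 := by linarith
  set r := q.conjExponent with hr
  have hr₁ : r - 1 = 1 / (q - 1) := by rw [hr, conjExponent]; field
  have hpr : ρ ^ 2 * (r - 1) = p - 1 := by rw [hr₁, ← hρ]; field
  have hr₂ : r - 1 ≤ 1 := by rw [hr₁, div_le_one hq₁]; linarith
  have hr₀ : 0 ≤ r - 1 := by rw [hr₁]; positivity
  have hle : p ≤ r := by nlinarith [pow_le_one₀ (n := 2) hρ₀ hρ₁]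
  have hρa : |ρ * a| ≤ 1 := by
    rw [abs_mul, abs_of_nonneg hρ₀]
    exact mul_le_one₀ hρ₁ (abs_nonneg a) ha
  refine (one_add_mul_le_twoPointMoment_mul (HolderConjugate.conjExponent (by linarith)).symm
    hρa hb).trans (mul_le_mul_of_nonneg_right ?_ (rpow_nonneg (twoPointMoment_pos hb).le _))
  exact twoPointMoment_rpow_one_div_le hp hle (by linarith) hρ₀ hρ₁ hpr ha

lemma sqrt_one_add_le_twoPointMoment {p a : ℝ} (hp : 1 < p) (hp₂ : p ≤ 2) (ha : |a| ≤ 1) :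
    √(1 + (p - 1) * a ^ 2) ≤ twoPointMoment p a ^ (1 / p) := by
  have hsq : √(p - 1) ^ 2 = p - 1 := sq_sqrt (by linarith)
  have := twoPointMoment_rpow_one_div_le hp hp₂ le_rfl (sqrt_nonneg (p - 1))
    (sqrt_le_one.2 (by linarith)) (by rw [hsq]; ring) ha
  rwa [twoPointMoment_two, mul_pow, hsq, ← sqrt_eq_rpow] at this

lemma one_add_mul_le_of_le_two {p q ρ a b : ℝ} (hp : 1 < p) (hp₂ : p ≤ 2) (hq : 1 < q)
    (hq₂ : q ≤ 2) (hρ : (p - 1) * (q - 1) = ρ ^ 2) (ha : |a| ≤ 1) (hb : |b| ≤ 1) :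
    1 + ρ * a * b ≤ twoPointMoment p a ^ (1 / p) * twoPointMoment q b ^ (1 / q) := by
  have hA : 0 ≤ (p - 1) * a ^ 2 := mul_nonneg (by linarith) (sq_nonneg a)
  have hB : 0 ≤ (q - 1) * b ^ 2 := mul_nonneg (by linarith) (sq_nonneg b)
  have hAB : (ρ * a * b) ^ 2 = ((p - 1) * a ^ 2) * ((q - 1) * b ^ 2) := by
    linear_combination (-(a ^ 2 * b ^ 2)) * hρ
  have hamgm : 2 * (ρ * a * b) ≤ (p - 1) * a ^ 2 + (q - 1) * b ^ 2 := by
    refine (abs_le_of_sq_le_sq' ?_ (by linarith)).2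
    nlinarith [sq_nonneg ((p - 1) * a ^ 2 - (q - 1) * b ^ 2)]
  calc 1 + ρ * a * b
      ≤ √((1 + (p - 1) * a ^ 2) * (1 + (q - 1) * b ^ 2)) := le_sqrt_of_sq_le (by nlinarith)
    _ = √(1 + (p - 1) * a ^ 2) * √(1 + (q - 1) * b ^ 2) := sqrt_mul (by linarith) _
    _ ≤ _ := mul_le_mul (sqrt_one_add_le_twoPointMoment hp hp₂ ha)
        (sqrt_one_add_le_twoPointMoment hq hq₂ hb) (sqrt_nonneg _)
        (rpow_nonneg (twoPointMoment_pos ha).le _)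

lemma one_le_twoPointMoment {p a : ℝ} (hp : 1 ≤ p) (ha : |a| ≤ 1) : 1 ≤ twoPointMoment p a := by
  have h₁ := one_add_mul_self_le_rpow_one_add (abs_le.1 ha).1 hp
  have h₂ := one_add_mul_self_le_rpow_one_add (s := -a) (neg_le_neg (abs_le.1 ha).2) hp
  rw [← sub_eq_add_neg] at h₂
  unfold twoPointMoment
  linarith

lemma one_add_mul_le_twoPointMoment_rpow_mul {p q ρ a b : ℝ} (hp : 1 ≤ p) (hq : 1 ≤ q)
    (hρ₀ : 0 ≤ ρ) (hρ₁ : ρ ≤ 1) (hρ : (p - 1) * (q - 1) = ρ ^ 2) (ha : |a| ≤ 1) (hb : |b| ≤ 1) :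
    1 + ρ * a * b ≤ twoPointMoment p a ^ (1 / p) * twoPointMoment q b ^ (1 / q) := by
  rcases hρ₀.eq_or_lt with rfl | hρ_pos
  · simpa using one_le_mul_of_one_le_of_one_le
      (one_le_rpow (one_le_twoPointMoment hp ha) (by positivity : 0 ≤ 1 / p))
      (one_le_rpow (one_le_twoPointMoment hq hb) (by positivity : 0 ≤ 1 / q))
  have hpq : 0 < (p - 1) * (q - 1) := hρ ▸ pow_pos hρ_pos 2
  have hp₁ : 1 < p := sub_pos.1 (pos_of_mul_pos_left hpq (by linarith))
  have hq₁ : 1 < q := sub_pos.1 (pos_of_mul_pos_right hpq (by linarith))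
  rcases le_total 2 q with hq₂ | hq₂
  · exact one_add_mul_le_of_two_le hp₁ hq₂ hρ₀ hρ₁ hρ ha hb
  rcases le_total 2 p with hp₂ | hp₂
  · rw [mul_right_comm, mul_comm (_ ^ (1 / p))]
    exact one_add_mul_le_of_two_le hq₁ hp₂ hρ₀ hρ₁ (by rw [mul_comm, hρ]) hb ha
  · exact one_add_mul_le_of_le_two hp₁ hp₂ hq₁ hq₂ hρ ha hb

lemma kronecker_mulVec_apply {X X' Y Y' : Type*} [Fintype X'] [Fintype Y'] (M : Matrix X X' ℝ)
    (N : Matrix Y Y' ℝ) (w : X' × Y' → ℝ) (x : X) (y : Y) :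
    (M ⊗ₖ N *ᵥ w) (x, y) = ∑ x', M x x' * (N *ᵥ fun y' => w (x', y')) y := by
  simp only [mulVec, dotProduct, Fintype.sum_prod_type, Matrix.kroneckerMap_apply, Finset.mul_sum,
    mul_assoc]

section Hypercontractivity

variable {X X' Y Y' : Type*} [Fintype X] [Fintype X'] [Fintype Y] [Fintype Y']

/-- The `L^p` norm of a nonnegative function on a finite type with its uniform probability
measure. There is no absolute value: the definition is only meant for nonnegative functions. -/
def lpMean (p : ℝ) (u : X → ℝ) : ℝ := (𝔼 x, u x ^ p) ^ (1 / p)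

lemma lpMean_nonneg (p : ℝ) {u : X → ℝ} (hu : 0 ≤ u) : 0 ≤ lpMean p u :=
  rpow_nonneg (Finset.expect_nonneg fun x _ => rpow_nonneg (hu x) p) _

lemma lpMean_rpow {p : ℝ} (hp : p ≠ 0) {u : X → ℝ} (hu : 0 ≤ u) :
    lpMean p u ^ p = 𝔼 x, u x ^ p := by
  rw [lpMean, ← rpow_mul (Finset.expect_nonneg fun x _ => rpow_nonneg (hu x) p),
    one_div_mul_cancel hp, rpow_one]

lemma lpMean_of_unique [Unique X] {p : ℝ} (hp : p ≠ 0) {u : X → ℝ} (hu : 0 ≤ u) :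
    lpMean p u = u default := by
  simp [lpMean, rpow_rpow_inv (hu default) hp]

lemma lpMean_lpMean {p : ℝ} (hp : p ≠ 0) {u : X × Y → ℝ} (hu : 0 ≤ u) :
    lpMean p (fun x => lpMean p fun y => u (x, y)) = lpMean p u := by
  rw [lpMean, lpMean, ← Finset.univ_product_univ, Finset.expect_product]
  simp only [fun x => lpMean_rpow (u := fun y => u (x, y)) hp fun y => hu (x, y)]

lemma lpMean_comp_equiv (p : ℝ) (e : X' ≃ X) (u : X → ℝ) : lpMean p (u ∘ e) = lpMean p u := by
  unfold lpMean
  rw [Fintype.expect_equiv e (fun x => (u ∘ e) x ^ p) (fun x => u x ^ p) fun _ => rfl]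

/-- The two-function form of hypercontractivity for a matrix acting on functions:
`𝔼 u · (M w) ≤ ‖u‖_p ‖w‖_q` for nonnegative `u` and `w`. -/
def IsHypercontractive (p q : ℝ) (M : Matrix X Y ℝ) : Prop :=
  ∀ u : X → ℝ, ∀ w : Y → ℝ, 0 ≤ u → 0 ≤ w → 𝔼 x, u x * (M *ᵥ w) x ≤ lpMean p u * lpMean q w

namespace IsHypercontractive

variable {p q : ℝ} {M : Matrix X X' ℝ} {N : Matrix Y Y' ℝ}

lemma kronecker (hM : IsHypercontractive p q M) (hN : IsHypercontractive p q N)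
    (hp : p ≠ 0) (hq : q ≠ 0) (hM₀ : ∀ x x', 0 ≤ M x x') : IsHypercontractive p q (M ⊗ₖ N) := by
  intro u w hu hw
  set U : X → ℝ := fun x => lpMean p fun y => u (x, y)
  set W : X' → ℝ := fun x' => lpMean q fun y' => w (x', y')
  have hU : 0 ≤ U := fun x => lpMean_nonneg p fun y => hu (x, y)
  have hW : 0 ≤ W := fun x' => lpMean_nonneg q fun y' => hw (x', y')
  calc 𝔼 z, u z * (M ⊗ₖ N *ᵥ w) z
      = 𝔼 x, ∑ x', M x x' * 𝔼 y, u (x, y) * (N *ᵥ fun y' => w (x', y')) y := by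
        rw [← Finset.univ_product_univ, Finset.expect_product]
        simp only [kronecker_mulVec_apply, Finset.mul_sum, Finset.mul_expect,
          Finset.expect_sum_comm, mul_left_comm]
    _ ≤ 𝔼 x, ∑ x', M x x' * (U x * W x') := by
        gcongr with x _ x' _
        · exact hM₀ x x'
        · exact hN _ _ (fun y => hu (x, y)) fun y' => hw (x', y')
    _ = 𝔼 x, U x * (M *ᵥ W) x := by
        simp only [mulVec, dotProduct, Finset.mul_sum, mul_left_comm]
    _ ≤ lpMean p U * lpMean q W := hM U W hU hW
    _ = lpMean p u * lpMean q w := by rw [lpMean_lpMean hp hu, lpMean_lpMean hq hw]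

lemma reindex (hM : IsHypercontractive p q M) (e : X ≃ Y) (e' : X' ≃ Y') :
    IsHypercontractive p q (Matrix.reindex e e' M) := by
  intro u w hu hw
  rw [← lpMean_comp_equiv p e, ← lpMean_comp_equiv q e']
  refine le_of_eq_of_le ?_ (hM (u ∘ e) (w ∘ e') (fun _ => hu _) fun _ => hw _)
  refine (Fintype.expect_equiv e _ _ fun x => ?_).symm
  rw [Matrix.reindex_apply, submatrix_mulVec_equiv]
  simp

end IsHypercontractive

end Hypercontractivity

section Noise

/-- The noise operator on one bit: the transition matrix which flips a sign with probability
`(1 - ρ) / 2`. -/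
def bitNoise (ρ : ℝ) : Matrix ℤˣ ℤˣ ℝ :=
  Matrix.of fun x y => if y = x then (1 + ρ) / 2 else (1 - ρ) / 2

/-- The noise operator on the cube `{±1}^ι`, as a matrix; for `ι = Fin n` its action on functions
is `noiseOp ρ`. -/
def cubeNoise (ρ : ℝ) (ι : Type) [Fintype ι] : Matrix (Cube ι) (Cube ι) ℝ :=
  Matrix.of fun x y => ∏ i, bitNoise ρ (x i) (y i)

variable {ρ : ℝ} {ι κ : Type} [Fintype ι] [Fintype κ]

lemma sum_units_int {R : Type*} [AddCommMonoid R] (g : ℤˣ → R) : ∑ x, g x = g 1 + g (-1) := by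
  rw [UnitsInt.univ, Finset.sum_pair (by decide)]

lemma bitNoise_mem_doublyStochastic (hρ : ρ ∈ Icc (0 : ℝ) 1) :
    bitNoise ρ ∈ doublyStochastic ℝ ℤˣ := by
  refine mem_doublyStochastic_iff_sum.2 ⟨fun x y => ?_, fun x => ?_, fun x => ?_⟩
  · simp only [bitNoise, Matrix.of_apply]
    split_ifs <;> linarith [hρ.1, hρ.2]
  all_goals
    rw [sum_units_int]
    rcases Int.units_eq_one_or x with rfl | rfl <;>
      simp only [bitNoise, Matrix.of_apply, if_true, if_neg (by decide : (1 : ℤˣ) ≠ -1),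
        if_neg (by decide : (-1 : ℤˣ) ≠ 1)] <;> ring

lemma cubeNoise_mem_doublyStochastic [DecidableEq ι] (hρ : ρ ∈ Icc (0 : ℝ) 1) :
    cubeNoise ρ ι ∈ doublyStochastic ℝ (Cube ι) := by
  have hbit := bitNoise_mem_doublyStochastic hρ
  refine mem_doublyStochastic_iff_sum.2 ⟨fun x y => Finset.prod_nonneg fun i _ =>
    nonneg_of_mem_doublyStochastic hbit, fun x => ?_, fun y => ?_⟩
  · simp only [cubeNoise, Matrix.of_apply, ← Fintype.prod_sum fun i y => bitNoise ρ (x i) y,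
      sum_row_of_mem_doublyStochastic hbit, Finset.prod_const_one]
  · simp only [cubeNoise, Matrix.of_apply, ← Fintype.prod_sum fun i x => bitNoise ρ x (y i),
      sum_col_of_mem_doublyStochastic hbit, Finset.prod_const_one]

lemma cubeNoise_reindex (e : ι ≃ κ) :
    cubeNoise ρ κ = Matrix.reindex (e.arrowCongr (Equiv.refl ℤˣ)) (e.arrowCongr (Equiv.refl ℤˣ))
      (cubeNoise ρ ι) := by
  ext x y
  exact (e.prod_comp fun i => bitNoise ρ (x i) (y i)).symm

lemma cubeNoise_option :
    cubeNoise ρ (Option ι) = Matrix.reindex Equiv.piOptionEquivProd.symm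
      Equiv.piOptionEquivProd.symm (bitNoise ρ ⊗ₖ cubeNoise ρ ι) := by
  ext x y
  exact Fintype.prod_option fun i => bitNoise ρ (x i) (y i)

lemma exists_eq_mul_one_add {u : ℤˣ → ℝ} (hu : 0 ≤ u) :
    ∃ m a : ℝ, 0 ≤ m ∧ |a| ≤ 1 ∧ u 1 = m * (1 + a) ∧ u (-1) = m * (1 - a) := by
  have h₁ : 0 ≤ u 1 := hu 1
  have h₂ : 0 ≤ u (-1) := hu (-1)
  rcases (add_nonneg h₁ h₂).eq_or_lt with h | h
  · exact ⟨0, 0, le_rfl, by simp, by linarith, by linarith⟩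
  · refine ⟨(u 1 + u (-1)) / 2, (u 1 - u (-1)) / (u 1 + u (-1)),
      by linarith, ?_, by field, by field⟩
    rw [abs_div, abs_of_pos h, div_le_one h, abs_le]
    constructor <;> linarith

lemma lpMean_eq_mul_twoPointMoment {p m a : ℝ} (hp : p ≠ 0) (hm : 0 ≤ m) (ha : |a| ≤ 1)
    {u : ℤˣ → ℝ} (hu₁ : u 1 = m * (1 + a)) (hu₂ : u (-1) = m * (1 - a)) :
    lpMean p u = m * twoPointMoment p a ^ (1 / p) := by
  have ⟨ha₁, ha₂⟩ := abs_le.1 ha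
  have : 𝔼 x, u x ^ p = m ^ p * twoPointMoment p a := by
    rw [Fintype.expect_eq_sum_div_card, sum_units_int, hu₁, hu₂, mul_rpow hm (by linarith),
      mul_rpow hm (by linarith), ← mul_add, mul_div_assoc, Fintype.card_units_int]
    rfl
  rw [lpMean, this, mul_rpow (rpow_nonneg hm p) (twoPointMoment_pos ha).le, ← rpow_mul hm,
    mul_one_div_cancel hp, rpow_one]

lemma isHypercontractive_bitNoise {p q : ℝ} (hp : 1 ≤ p) (hq : 1 ≤ q) (hρ : ρ ∈ Icc (0 : ℝ) 1)
    (hpq : (p - 1) * (q - 1) = ρ ^ 2) : IsHypercontractive p q (bitNoise ρ) := by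
  intro u w hu hw
  obtain ⟨m, a, hm, ha, hu₁, hu₂⟩ := exists_eq_mul_one_add hu
  obtain ⟨l, b, hl, hb, hw₁, hw₂⟩ := exists_eq_mul_one_add hw
  rw [lpMean_eq_mul_twoPointMoment (by linarith) hm ha hu₁ hu₂,
    lpMean_eq_mul_twoPointMoment (by linarith) hl hb hw₁ hw₂]
  calc 𝔼 x, u x * (bitNoise ρ *ᵥ w) x = m * l * (1 + ρ * a * b) := by
        rw [Fintype.expect_eq_sum_div_card]
        simp only [mulVec, dotProduct, sum_units_int, bitNoise, Matrix.of_apply, if_true,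
          if_neg (by decide : (1 : ℤˣ) ≠ -1), if_neg (by decide : (-1 : ℤˣ) ≠ 1), hu₁, hu₂, hw₁,
          hw₂, Fintype.card_units_int]
        push_cast
        ring
    _ ≤ m * l * (twoPointMoment p a ^ (1 / p) * twoPointMoment q b ^ (1 / q)) := by
        gcongr
        exact one_add_mul_le_twoPointMoment_rpow_mul hp hq hρ.1 hρ.2 hpq ha hb
    _ = m * twoPointMoment p a ^ (1 / p) * (l * twoPointMoment q b ^ (1 / q)) := by ring

theorem isHypercontractive_cubeNoise [DecidableEq ι] {p q : ℝ} (hp : 1 ≤ p) (hq : 1 ≤ q)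
    (hρ : ρ ∈ Icc (0 : ℝ) 1) (hpq : (p - 1) * (q - 1) = ρ ^ 2) :
    IsHypercontractive p q (cubeNoise ρ ι) := by
  classical
  have hp₀ : p ≠ 0 := by linarith
  have hq₀ : q ≠ 0 := by linarith
  revert ‹DecidableEq ι›
  refine Fintype.induction_empty_option (P := fun ι _ => ∀ [DecidableEq ι],
    IsHypercontractive p q (cubeNoise ρ ι)) ?_ ?_ ?_ ι
  · intro ι κ _ e ih _
    let := Fintype.ofEquiv κ e.symm
    exact cubeNoise_reindex (ρ := ρ) e ▸ ih.reindex _ _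
  · intro _ u w hu hw
    rw [lpMean_of_unique hp₀ hu, lpMean_of_unique hq₀ hw]
    simp [cubeNoise, mulVec, dotProduct]
  · intro ι _ ih _
    rw [cubeNoise_option]
    exact ((isHypercontractive_bitNoise hp hq hρ hpq).kronecker ih hp₀ hq₀ fun _ _ =>
      nonneg_of_mem_doublyStochastic (bitNoise_mem_doublyStochastic hρ)).reindex _ _

end Noise

section Level

lemma level_nonneg (α : ℝ) : 0 ≤ level α := Real.sqrt_nonneg _

lemma level_one : level 1 = 0 := by simp [level]

lemma level_sq {α : ℝ} (h0 : 0 ≤ α) (h1 : α ≤ 1) : level α ^ 2 = -2 * log α :=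
  Real.sq_sqrt (by linarith [log_nonpos h0 h1])

lemma exp_neg_level_sq {α : ℝ} (h0 : 0 < α) (h1 : α ≤ 1) : exp (-(level α ^ 2 / 2)) = α := by
  rw [level_sq h0.le h1, show -(-2 * log α / 2) = log α by ring, exp_log h0]

lemma strictAntiOn_level : StrictAntiOn level (Ioc 0 1) := fun α hα β hβ hαβ =>
  Real.sqrt_lt_sqrt (by linarith [log_nonpos hβ.1.le hβ.2]) (by linarith [log_lt_log hα.1 hαβ])

lemma level_pos {α : ℝ} (h0 : 0 < α) (h1 : α < 1) : 0 < level α := by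
  simpa only [level_one] using strictAntiOn_level ⟨h0, h1.le⟩ ⟨one_pos, le_rfl⟩ h1

lemma measurable_level : Measurable level := by
  unfold level; fun_prop

lemma continuousAt_level {β : ℝ} (h : β ≠ 0) : ContinuousAt level β :=
  ((continuousAt_log h).const_mul (-2)).sqrt

lemma hasDerivAt_level {β : ℝ} (h0 : 0 < β) (h1 : β < 1) :
    HasDerivAt level (-1 / (β * level β)) β := by
  have h2 : -2 * log β ≠ 0 := by linarith [log_neg h0 h1]
  refine (((hasDerivAt_log h0.ne').const_mul (-2)).sqrt h2).congr_deriv ?_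
  rw [← level]
  have := (level_pos h0 h1).ne'
  field_simp

lemma antitoneOn_log_mul_log_one_sub :
    AntitoneOn (fun x => log x * log (1 - x)) (Ico (1 / 2) 1) := by
  have hderiv : ∀ x ∈ Ico (1 / 2 : ℝ) 1, HasDerivAt (fun x => log x * log (1 - x))
      (x⁻¹ * log (1 - x) + log x * (-1 / (1 - x))) x := fun x hx =>
    (hasDerivAt_log (by linarith [hx.1])).mul
      (((hasDerivAt_id x).const_sub 1).log (by simp only [id]; linarith [hx.2]))
  refine antitoneOn_of_deriv_nonpos (convex_Ico _ _)
    (fun x hx => (hderiv x hx).continuousAt.continuousWithinAt)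
    (fun x hx => (hderiv x (interior_subset hx)).differentiableAt.differentiableWithinAt)
    fun x hx => ?_
  rw [(hderiv x (interior_subset hx)).deriv]
  rw [interior_Ico] at hx
  obtain ⟨hx_half, hx_one⟩ := hx
  -- By concavity of `log`, the secant slope towards `1` is larger from `1 - x` than from `x`.
  have secant := strictConcaveOn_log_Ioi.secant_strict_mono (a := 1) (x := 1 - x) (y := x)
    (by simp) (by simpa using hx_one) (by simp only [mem_Ioi]; linarith) (by linarith)
    (by linarith) (by linarith)
  rw [log_one, sub_zero, sub_zero, show x - 1 = -(1 - x) by ring, show 1 - x - 1 = -x by ring,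
    div_neg, div_neg] at secant
  rw [inv_mul_eq_div, mul_div_assoc', mul_neg_one, neg_div]
  linarith

lemma log_mul_log_one_sub_le {p q : ℝ} (hp : 1 - q ≤ p) (hpq : p ≤ q) (hq : q < 1) :
    log q * log (1 - q) ≤ log p * log (1 - p) := by
  rcases le_total (1 / 2) p with h | h
  · exact antitoneOn_log_mul_log_one_sub ⟨h, by linarith⟩ ⟨by linarith, hq⟩ hpq
  · have := antitoneOn_log_mul_log_one_sub (a := 1 - p) (b := q) ⟨by linarith, by linarith⟩
      ⟨by linarith, hq⟩ (by linarith)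
    simpa only [sub_sub_cancel, mul_comm (log (1 - p))] using this

lemma level_one_sub_lt_mul_level_one_sub {ρ α β : ℝ} (hρ : ρ ∈ Icc (0 : ℝ) 1) (hα : 0 < α)
    (hβ : 0 < β) (hαβ : α + β < 1) (h : level α < ρ * level β) :
    level (1 - β) < ρ * level (1 - α) := by
  have hρ_pos : 0 < ρ := pos_of_mul_pos_left ((level_nonneg α).trans_lt h) (level_nonneg β)
  have hlogβ : log β < 0 := log_neg hβ (by linarith)
  by_contra! hcon
  have hα_sq := pow_lt_pow_left₀ h (level_nonneg _) two_ne_zero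
  have hβ_sq := pow_le_pow_left₀ (mul_nonneg hρ_pos.le (level_nonneg _)) hcon 2
  rw [mul_pow, level_sq (by linarith) (by linarith), level_sq (by linarith) (by linarith)]
    at hα_sq hβ_sq
  set p := β ^ (ρ ^ 2)
  have hp_pos : 0 < p := rpow_pos_of_pos hβ _
  have hlogp : log p = ρ ^ 2 * log β := log_rpow hβ _
  have hpα : p < α := by
    rw [← log_lt_log_iff hp_pos hα, hlogp]; linarith
  have hβp : β ≤ p := by
    simpa only [rpow_one] using rpow_le_rpow_of_exponent_ge hβ (by linarith)
      (pow_le_one₀ hρ.1 hρ.2 (n := 2))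
  have hG := log_mul_log_one_sub_le (p := p) (q := 1 - β) (by linarith) (by linarith) (by linarith)
  have hlog_sub : log (1 - α) < log (1 - p) := log_lt_log (by linarith) (by linarith)
  have hlog : log (1 - β) < ρ ^ 2 * log (1 - p) := by
    linarith [mul_lt_mul_of_pos_left hlog_sub (pow_pos hρ_pos 2)]
  rw [sub_sub_cancel, hlogp] at hG
  linarith [mul_lt_mul_of_neg_right hlog hlogβ]

end Level

section Theta

/-- The boundary points `β` of the cases in the definition of `θ_α(β)`, where
`Θ(α, ·)` need not be differentiable. -/
def IsCritical (ρ α β : ℝ) : Prop :=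
  level α = ρ * level β ∨ level β = ρ * level α

lemma countable_isCritical {ρ α : ℝ} (hα : α ∈ Ioo (0 : ℝ) 1) :
    {β ∈ Ioo 0 1 | IsCritical ρ α β}.Countable := by
  refine MapsTo.countable_of_injOn (f := level) (t := {level α / ρ, ρ * level α}) ?_
    (strictAntiOn_level.injOn.mono fun β hβ => Ioo_subset_Ioc_self hβ.1) (toFinite _).countable
  rintro β ⟨-, h | h⟩
  · have hρ : ρ ≠ 0 := by
      rintro rfl
      exact (level_pos hα.1 hα.2).ne' (by simpa using h)
    exact Or.inl (by rw [h]; field_simp)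
  · exact Or.inr h

/-- The derivative in `β` of the small-set-expansion bound `expansionBound ρ α β` below, in terms
of the levels `s` of `α` and `t` of `β`. -/
def slope (ρ s t : ℝ) : ℝ :=
  open Classical in
  if ρ * s ≤ t ∧ ρ * t ≤ s then branch ρ s t else if t ≤ ρ * s then 0 else 1

lemma theta_of_add_lt_one {ρ α β : ℝ} (hρ : ρ ∈ Icc (0 : ℝ) 1) (hα : 0 < α) (hβ : 0 < β)
    (h : α + β < 1) :
    theta ρ α β = slope ρ (level α) (level β) := by
  have hlevel : level (1 - α) < level β :=
    strictAntiOn_level ⟨hβ, by linarith⟩ ⟨by linarith, by linarith⟩ (by linarith)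
  have hbelow := level_one_sub_lt_mul_level_one_sub hρ hα hβ h
  have habove := level_one_sub_lt_mul_level_one_sub hρ hβ hα (by linarith)
  have hs : ρ * level α ≤ level α := mul_le_of_le_one_left (level_nonneg _) hρ.2
  have ht : ρ * level β ≤ level β := mul_le_of_le_one_left (level_nonneg _) hρ.2
  rw [theta, if_neg (by linarith), if_neg (by linarith), thetaAux, slope]
  grind

lemma theta_of_one_lt_add {ρ α β : ℝ} (hρ : ρ ∈ Icc (0 : ℝ) 1) (hα : α < 1) (hβ : β < 1)
    (h : 1 < α + β) (hcrit : ¬ IsCritical ρ (1 - α) (1 - β)) :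
    theta ρ α β = 1 - slope ρ (level (1 - α)) (level (1 - β)) := by
  have hlevel : level β < level (1 - α) :=
    strictAntiOn_level ⟨by linarith, by linarith⟩ ⟨by linarith, by linarith⟩ (by linarith)
  have hbelow := level_one_sub_lt_mul_level_one_sub (α := 1 - α) (β := 1 - β) hρ
    (by linarith) (by linarith) (by linarith)
  have habove := level_one_sub_lt_mul_level_one_sub (α := 1 - β) (β := 1 - α) hρ
    (by linarith) (by linarith) (by linarith)
  have hs : ρ * level (1 - α) ≤ level (1 - α) := mul_le_of_le_one_left (level_nonneg _) hρ.2
  have ht : ρ * level (1 - β) ≤ level (1 - β) := mul_le_of_le_one_left (level_nonneg _) hρ.2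
  simp only [sub_sub_cancel] at hbelow habove
  rw [IsCritical] at hcrit
  rw [theta, if_neg (by linarith), if_neg (by linarith), thetaAux, slope]
  grind

lemma branch_mem_Icc {ρ s t : ℝ} (hρ : ρ ∈ Icc (0 : ℝ) 1) (ht : 0 ≤ t) (hst : ρ * s ≤ t)
    (hts : ρ * t ≤ s) : branch ρ s t ∈ Icc (0 : ℝ) 1 := by
  rcases ht.eq_or_lt with rfl | ht
  · simp [branch]
  rcases hρ.2.eq_or_lt with rfl | hρ1
  · simp [branch]
  have hρ_sq : 0 < 1 - ρ ^ 2 := by nlinarith [hρ.1]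
  have hquot : 0 ≤ (t - ρ * s) / ((1 - ρ ^ 2) * t) := div_nonneg (by linarith) (by positivity)
  refine ⟨mul_nonneg hquot (exp_pos _).le, mul_le_one₀ ?_ (exp_pos _).le ?_⟩
  · rw [div_le_one (by positivity)]
    nlinarith [mul_le_mul_of_nonneg_left hts hρ.1]
  · rw [exp_le_one_iff, sub_nonpos, le_div_iff₀ (by positivity)]
    nlinarith [sq_nonneg (s - ρ * t)]

lemma theta_mem_Icc {ρ : ℝ} (hρ : ρ ∈ Icc (0 : ℝ) 1) (α β : ℝ) :
    theta ρ α β ∈ Icc (0 : ℝ) 1 := by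
  unfold theta thetaAux
  split_ifs with _ _ h h
  · simp
  · simp
  · exact branch_mem_Icc hρ (level_nonneg _) h.1.1 h.1.2
  · exact Icc.mem_iff_one_sub_mem.1 (branch_mem_Icc hρ (level_nonneg _) h.1.1 h.1.2)
  · simp
  · simp

lemma measurable_branch (ρ s : ℝ) : Measurable (branch ρ s) := by
  unfold branch; fun_prop

lemma measurable_theta (ρ α : ℝ) : Measurable (theta ρ α) := by
  have hlevel := measurable_level
  have hbranch := measurable_branch ρ
  unfold theta thetaAux
  refine Measurable.ite (.const _) measurable_const (Measurable.ite (.const _) measurable_const ?_)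
  refine Measurable.ite ?_ (by fun_prop) (Measurable.ite ?_ (by fun_prop)
    (Measurable.ite ?_ measurable_const measurable_const)) <;>
  measurability

lemma intervalIntegrable_theta {ρ : ℝ} (hρ : ρ ∈ Icc (0 : ℝ) 1) (α a b : ℝ) :
    IntervalIntegrable (theta ρ α) volume a b := by
  refine intervalIntegrable_const (c := (1 : ℝ)) |>.mono_fun
    (measurable_theta ρ α).aestronglyMeasurable (.of_forall fun β => ?_)
  simp only [norm_of_nonneg (theta_mem_Icc hρ α β).1, norm_one]
  exact (theta_mem_Icc hρ α β).2

end Theta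

section ExpansionBound

open Classical in
/-- `-log Θ(α, β)` for `α + β ≤ 1`, in terms of the levels `s` of `α` and `t` of `β`. -/
def boundExponent (ρ s t : ℝ) : ℝ :=
  if s ≤ ρ * t then t ^ 2 / 2
  else if t ≤ ρ * s then s ^ 2 / 2
  else (s ^ 2 + t ^ 2 - 2 * ρ * s * t) / (2 * (1 - ρ ^ 2))

open Classical in
/-- The small-set-expansion bound on `𝔼[1_B T_ρ f]`, where `f : {±1}^n → [0, 1]` has mean `α` and
`B` has measure `β`. For `β ≤ 0` the level of `β` is a junk value, and the bound is set to `0`. -/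
def expansionBound (ρ α β : ℝ) : ℝ :=
  if β ≤ 0 then 0 else exp (-boundExponent ρ (level α) (level β))

variable {ρ s t α β : ℝ}

lemma lt_one_of_mul_lt_of_mul_lt (hs : 0 ≤ s) (ht : 0 ≤ t) (hts : ρ * t < s) (hst : ρ * s < t) :
    ρ < 1 := by
  by_contra! hρ
  linarith [le_mul_of_one_le_left hs hρ, le_mul_of_one_le_left ht hρ]

lemma one_sub_sq_pos (hρ0 : 0 ≤ ρ) (hρ1 : ρ < 1) : 0 < 1 - ρ ^ 2 :=
  sub_pos.2 (pow_lt_one₀ hρ0 hρ1 two_ne_zero)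

lemma boundExponent_comm (hρ : ρ ≤ 1) (hs : 0 ≤ s) (ht : 0 ≤ t) :
    boundExponent ρ s t = boundExponent ρ t s := by
  have hρs := mul_le_of_le_one_left hs hρ
  have hρt := mul_le_of_le_one_left ht hρ
  unfold boundExponent
  split_ifs with h₁ h₂
  · rw [show s = t by linarith]
  · rfl
  · rfl
  · ring

lemma sq_div_two_le_boundExponent (hρ : ρ ∈ Icc (0 : ℝ) 1) (hs : 0 ≤ s) (ht : 0 ≤ t) :
    t ^ 2 / 2 ≤ boundExponent ρ s t := by
  unfold boundExponent
  split_ifs with h₁ h₂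
  · rfl
  · gcongr
    exact h₂.trans (mul_le_of_le_one_left hs hρ.2)
  · push Not at h₁ h₂
    have hρ_sq := one_sub_sq_pos hρ.1 (lt_one_of_mul_lt_of_mul_lt hs ht h₁ h₂)
    rw [div_le_div_iff₀ two_pos (by positivity)]
    linarith [sq_nonneg (s - ρ * t)]

lemma continuous_boundExponent (hρ : ρ ∈ Icc (0 : ℝ) 1) (hs : 0 < s) :
    Continuous (boundExponent ρ s) := by
  rcases hρ.2.eq_or_lt with rfl | hρ1
  · have hmax : boundExponent 1 s = fun t => if s ≤ t then t ^ 2 / 2 else s ^ 2 / 2 := by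
      ext t
      grind [boundExponent]
    rw [hmax]
    exact Continuous.if_le (by fun_prop) (by fun_prop) continuous_const continuous_id
      (by rintro t rfl; rfl)
  have hρ_sq := one_sub_sq_pos hρ.1 hρ1
  unfold boundExponent
  refine Continuous.if_le (by fun_prop) (Continuous.if_le (by fun_prop) (by fun_prop)
    (by fun_prop) (by fun_prop) ?_) (by fun_prop) (by fun_prop) ?_
  · rintro t rfl
    field_simp
    ring
  · rintro t rfl
    have ht : 0 < t := pos_of_mul_pos_right hs hρ.1
    rw [if_neg (by linarith [mul_pos ht hρ_sq])]
    field_simp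
    ring

lemma expansionBound_of_pos (hβ : 0 < β) :
    expansionBound ρ α β = exp (-boundExponent ρ (level α) (level β)) :=
  if_neg hβ.not_ge

lemma expansionBound_of_nonpos (hβ : β ≤ 0) : expansionBound ρ α β = 0 := if_pos hβ

lemma expansionBound_comm (hρ : ρ ≤ 1) (hα : 0 < α) (hβ : 0 < β) :
    expansionBound ρ α β = expansionBound ρ β α := by
  rw [expansionBound_of_pos hα, expansionBound_of_pos hβ,
    boundExponent_comm hρ (level_nonneg α) (level_nonneg β)]

lemma expansionBound_nonneg (ρ α β : ℝ) : 0 ≤ expansionBound ρ α β := by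
  unfold expansionBound
  split_ifs
  · rfl
  · positivity

lemma expansionBound_le_max (hρ : ρ ∈ Icc (0 : ℝ) 1) (hβ : β ≤ 1) :
    expansionBound ρ α β ≤ max β 0 := by
  rcases le_or_gt β 0 with h | h
  · rw [expansionBound_of_nonpos h]
    exact le_max_right _ _
  · rw [max_eq_left h.le, expansionBound_of_pos h]
    conv_rhs => rw [← exp_neg_level_sq h hβ]
    exact exp_le_exp.2 (neg_le_neg (sq_div_two_le_boundExponent hρ (level_nonneg _)
      (level_nonneg _)))

lemma continuous_expansionBound (hρ : ρ ∈ Icc (0 : ℝ) 1) (hα : α ∈ Ioo (0 : ℝ) 1) :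
    Continuous (expansionBound ρ α) := by
  rw [continuous_iff_continuousAt]
  intro β
  rcases le_or_gt β 0 with h | h
  · rw [ContinuousAt, expansionBound_of_nonpos h]
    have hmax : Filter.Tendsto (fun x : ℝ => max x 0) (nhds β) (nhds 0) := by
      simpa only [max_eq_right h] using
        (Continuous.max continuous_id continuous_const).tendsto (f := fun x : ℝ => max x 0) β
    refine tendsto_of_tendsto_of_tendsto_of_le_of_le' tendsto_const_nhds hmax
      (.of_forall (expansionBound_nonneg ρ α)) ?_
    filter_upwards [gt_mem_nhds (h.trans_lt one_pos)] with x hx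
    exact expansionBound_le_max hρ hx.le
  · have hexp : ContinuousAt (fun x => exp (-boundExponent ρ (level α) (level x))) β :=
      ((continuous_boundExponent hρ (level_pos hα.1 hα.2)).continuousAt.comp
        (continuousAt_level h.ne')).neg.rexp
    refine hexp.congr ?_
    filter_upwards [lt_mem_nhds h] with x hx
    rw [expansionBound_of_pos hx]

open Classical in
lemma hasDerivAt_boundExponent (hst : s ≠ ρ * t) (hts : t ≠ ρ * s) :
    HasDerivAt (boundExponent ρ s)
      (if s ≤ ρ * t then t else if t ≤ ρ * s then 0 else (t - ρ * s) / (1 - ρ ^ 2)) t := by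
  have hcont : ContinuousAt (fun x => ρ * x) t := by fun_prop
  rcases hst.lt_or_gt with hst | hst
  · rw [if_pos hst.le]
    refine HasDerivAt.congr_of_eventuallyEq (f₁ := boundExponent ρ s)
      (f := fun x => x ^ 2 / 2) ?_ ?_
    · simpa using (hasDerivAt_pow 2 t).div_const 2
    · filter_upwards [hcont.eventually (lt_mem_nhds hst)] with x hx
      rw [boundExponent, if_pos hx.le]
  rw [if_neg hst.not_ge]
  rcases hts.lt_or_gt with hts | hts
  · rw [if_pos hts.le]
    refine (hasDerivAt_const t (s ^ 2 / 2)).congr_of_eventuallyEq ?_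
    filter_upwards [hcont.eventually (gt_mem_nhds hst), gt_mem_nhds hts] with x hx hx'
    rw [boundExponent, if_neg hx.not_ge, if_pos hx'.le]
  · rw [if_neg hts.not_ge]
    refine HasDerivAt.congr_of_eventuallyEq (f₁ := boundExponent ρ s)
      (f := fun x => (s ^ 2 + x ^ 2 - 2 * ρ * s * x) / (2 * (1 - ρ ^ 2))) ?_ ?_
    · refine ((((hasDerivAt_pow 2 t).const_add (s ^ 2)).sub
        ((hasDerivAt_id t).const_mul (2 * ρ * s))).div_const (2 * (1 - ρ ^ 2))).congr_deriv ?_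
      rw [← mul_div_mul_left (t - ρ * s) _ two_ne_zero]
      ring
    · filter_upwards [hcont.eventually (gt_mem_nhds hst), lt_mem_nhds hts] with x hx hx'
      rw [boundExponent, if_neg hx.not_ge, if_neg hx'.not_ge]

open Classical in
lemma slope_eq_exp_mul (hst : s ≠ ρ * t) (hts : t ≠ ρ * s) (hρ : ρ ∈ Icc (0 : ℝ) 1)
    (hs : 0 < s) (ht : 0 < t) :
    slope ρ s t = exp (t ^ 2 / 2 - boundExponent ρ s t) * ((if s ≤ ρ * t then t
      else if t ≤ ρ * s then 0 else (t - ρ * s) / (1 - ρ ^ 2)) / t) := by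
  have hρs := mul_le_of_le_one_left hs.le hρ.2
  have hρt := mul_le_of_le_one_left ht.le hρ.2
  unfold slope boundExponent
  by_cases h₁ : s ≤ ρ * t
  · have h₁' := h₁.lt_of_ne hst
    rw [if_neg (fun h => h₁'.not_ge h.2), if_neg (by linarith), if_pos h₁, if_pos h₁]
    simp [ht.ne']
  rw [if_neg h₁, if_neg h₁]
  by_cases h₂ : t ≤ ρ * s
  · have h₂' := h₂.lt_of_ne hts
    rw [if_neg (fun h => h₂'.not_ge h.1), if_pos h₂, if_pos h₂, if_pos h₂,
      zero_div, mul_zero]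
  · rw [if_pos ⟨(not_le.1 h₂).le, (not_le.1 h₁).le⟩, if_neg h₂, if_neg h₂, branch,
      div_div, mul_comm]

lemma hasDerivAt_expansionBound (hρ : ρ ∈ Icc (0 : ℝ) 1) (hα : α ∈ Ioo (0 : ℝ) 1)
    (hβ : β ∈ Ioo (0 : ℝ) 1) (hcrit : ¬ IsCritical ρ α β) :
    HasDerivAt (expansionBound ρ α) (slope ρ (level α) (level β)) β := by
  obtain ⟨hst, hts⟩ := not_or.1 hcrit
  have hexp := (((hasDerivAt_boundExponent hst hts).comp β (hasDerivAt_level hβ.1 hβ.2)).neg).exp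
  refine (hexp.congr_of_eventuallyEq ?_).congr_deriv ?_
  · filter_upwards [lt_mem_nhds hβ.1] with x hx
    rw [expansionBound_of_pos hx]
    rfl
  · have ht := level_pos hβ.1 hβ.2
    have hβ_inv : exp (level β ^ 2 / 2) = β⁻¹ := by
      rw [← inv_inv (exp _), ← Real.exp_neg, exp_neg_level_sq hβ.1 hβ.2.le]
    rw [slope_eq_exp_mul hst hts hρ (level_pos hα.1 hα.2) ht,
      sub_eq_neg_add (level β ^ 2 / 2), Real.exp_add, hβ_inv]
    simp only [Pi.neg_apply, Function.comp_apply]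
    field_simp

end ExpansionBound

section NoiseBound

open Classical in
/-- The small-set-expansion bound `Θ(α, β)` on `𝔼[1_B T_ρ f]`, where `f : {±1}^n → [0, 1]` has
mean `α` and `B` has measure `β`. For `α + β > 1` it comes from `expansionBound` applied to `1 - f`
and the complement of `B`. -/
def noiseBound (ρ α β : ℝ) : ℝ :=
  if α + β ≤ 1 then expansionBound ρ α β else α + β - 1 + expansionBound ρ (1 - α) (1 - β)

variable {ρ α β : ℝ}

lemma continuous_noiseBound (hρ : ρ ∈ Icc (0 : ℝ) 1) (hα : α ∈ Ioo (0 : ℝ) 1) :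
    Continuous (noiseBound ρ α) := by
  have hα' := Ioo.mem_iff_one_sub_mem.1 hα
  refine Continuous.if_le (continuous_expansionBound hρ hα) ?_ (by fun_prop) continuous_const ?_
  · exact ((continuous_const.add continuous_id).sub continuous_const).add
      ((continuous_expansionBound hρ hα').comp (continuous_const.sub continuous_id))
  · intro β h
    obtain rfl : β = 1 - α := by linarith
    rw [expansionBound_comm hρ.2 hα.1 hα'.1, sub_sub_cancel]
    ring

lemma hasDerivAt_noiseBound (hρ : ρ ∈ Icc (0 : ℝ) 1) (hα : α ∈ Ioo (0 : ℝ) 1)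
    (hβ : β ∈ Ioo (0 : ℝ) 1) (hne : α + β ≠ 1) (hcrit : ¬ IsCritical ρ α β)
    (hcrit' : ¬ IsCritical ρ (1 - α) (1 - β)) :
    HasDerivAt (noiseBound ρ α) (theta ρ α β) β := by
  have hcont : ContinuousAt (fun x => α + x) β := by fun_prop
  rcases hne.lt_or_gt with h | h
  · rw [theta_of_add_lt_one hρ hα.1 hβ.1 h]
    refine (hasDerivAt_expansionBound hρ hα hβ hcrit).congr_of_eventuallyEq ?_
    filter_upwards [hcont.eventually (gt_mem_nhds h)] with x hx using if_pos hx.le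
  · rw [theta_of_one_lt_add hρ hα.2 hβ.2 h hcrit']
    have hderiv := (((hasDerivAt_id β).const_add α).sub_const 1).add
      ((hasDerivAt_expansionBound hρ (Ioo.mem_iff_one_sub_mem.1 hα)
        (Ioo.mem_iff_one_sub_mem.1 hβ) hcrit').comp β ((hasDerivAt_id β).const_sub 1))
    refine (hderiv.congr_of_eventuallyEq ?_).congr_deriv (by ring)
    filter_upwards [hcont.eventually (lt_mem_nhds h)] with x hx using if_neg hx.not_ge

lemma integral_theta_eq_noiseBound (hρ : ρ ∈ Icc (0 : ℝ) 1) (hα : α ∈ Ioo (0 : ℝ) 1)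
    (hβ : β ∈ Icc (0 : ℝ) 1) : ∫ u in (0 : ℝ)..β, theta ρ α u = noiseBound ρ α β := by
  set exceptional : Set ℝ := {1 - α} ∪ {u ∈ Ioo 0 1 | IsCritical ρ α u} ∪
    (fun u => 1 - u) '' {u ∈ Ioo 0 1 | IsCritical ρ (1 - α) u}
  have hcount : exceptional.Countable := ((countable_singleton _).union
    (countable_isCritical hα)).union ((countable_isCritical (Ioo.mem_iff_one_sub_mem.1 hα)).image _)
  have hzero : noiseBound ρ α 0 = 0 := by
    rw [noiseBound, if_pos (by linarith [hα.2]), expansionBound_of_nonpos le_rfl]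
  rw [integral_eq_of_hasDerivAt_off_countable_of_le (noiseBound ρ α) (theta ρ α) hβ.1 hcount
    (continuous_noiseBound hρ hα).continuousOn ?_ (intervalIntegrable_theta hρ α 0 β), hzero,
    sub_zero]
  rintro u ⟨⟨hu0, huβ⟩, hu⟩
  have hu01 : u ∈ Ioo (0 : ℝ) 1 := ⟨hu0, huβ.trans_le hβ.2⟩
  refine hasDerivAt_noiseBound hρ hα hu01
    (fun h => hu (Or.inl (Or.inl (show u = 1 - α by linarith))))
    (fun h => hu (Or.inl (Or.inr ⟨hu01, h⟩))) (fun h => hu (Or.inr ?_))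
  exact ⟨1 - u, ⟨Ioo.mem_iff_one_sub_mem.1 hu01, h⟩, sub_sub_cancel 1 u⟩

lemma integral_theta (hρ : ρ ∈ Icc (0 : ℝ) 1) (hα : α ∈ Icc (0 : ℝ) 1) :
    ∫ u in (0 : ℝ)..1, theta ρ α u = α := by
  rcases hα.1.eq_or_lt with rfl | h0
  · simp [theta]
  rcases hα.2.eq_or_lt with rfl | h1
  · simp [theta]
  rw [integral_theta_eq_noiseBound hρ ⟨h0, h1⟩ ⟨zero_le_one, le_rfl⟩, noiseBound,
    if_neg (by linarith), sub_self, expansionBound_of_nonpos le_rfl]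
  ring

end NoiseBound

section SmallSetExpansion

variable {X : Type*} [Fintype X]

lemma expect_mem_Icc {f : X → ℝ} (hf : ∀ x, f x ∈ Icc (0 : ℝ) 1) :
    𝔼 x, f x ∈ Icc (0 : ℝ) 1 := by
  refine ⟨Finset.expect_nonneg fun x _ => (hf x).1, ?_⟩
  rw [Fintype.expect_eq_sum_div_card]
  refine div_le_one_of_le₀ ?_ (Nat.cast_nonneg _)
  simpa using Finset.sum_le_sum fun x (_ : x ∈ Finset.univ) => (hf x).2

lemma lpMean_le_expect_rpow {p : ℝ} (hp : 1 ≤ p) {f : X → ℝ} (hf : ∀ x, f x ∈ Icc (0 : ℝ) 1) :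
    lpMean p f ≤ (𝔼 x, f x) ^ (1 / p) := by
  refine rpow_le_rpow (Finset.expect_nonneg fun x _ => rpow_nonneg (hf x).1 p) ?_ (by positivity)
  gcongr with x _
  exact rpow_le_self_of_le_one (hf x).1 (hf x).2 hp

variable [DecidableEq X] {M : Matrix X X ℝ} {f g : X → ℝ}

lemma mulVec_one_sub (hM : M ∈ doublyStochastic ℝ X) (x : X) :
    (M *ᵥ (1 - f)) x = 1 - (M *ᵥ f) x := by
  rw [mulVec_sub, mulVec_one_of_mem_doublyStochastic hM, Pi.sub_apply, Pi.one_apply]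

lemma mulVec_nonneg (hM : M ∈ doublyStochastic ℝ X) (hf : 0 ≤ f) (x : X) : 0 ≤ (M *ᵥ f) x :=
  Finset.sum_nonneg fun y _ => mul_nonneg (nonneg_of_mem_doublyStochastic hM) (hf y)

lemma mulVec_mem_Icc (hM : M ∈ doublyStochastic ℝ X) (hf : ∀ x, f x ∈ Icc (0 : ℝ) 1) (x : X) :
    (M *ᵥ f) x ∈ Icc (0 : ℝ) 1 := by
  refine ⟨mulVec_nonneg hM (fun y => (hf y).1) x, ?_⟩
  have := mulVec_nonneg hM (f := 1 - f) (fun y => sub_nonneg.2 (hf y).2) x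
  rwa [mulVec_one_sub hM, sub_nonneg] at this

lemma expect_mulVec (hM : M ∈ doublyStochastic ℝ X) (f : X → ℝ) :
    𝔼 x, (M *ᵥ f) x = 𝔼 x, f x := by
  rw [Fintype.expect_eq_sum_div_card, sum_mulVec_of_mem_doublyStochastic hM,
    Fintype.expect_eq_sum_div_card]

lemma expect_mul_mulVec_le_left (hM : M ∈ doublyStochastic ℝ X) (hf : ∀ x, f x ∈ Icc (0 : ℝ) 1)
    (hg : 0 ≤ g) : 𝔼 x, g x * (M *ᵥ f) x ≤ 𝔼 x, g x := by
  gcongr with x _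
  exact mul_le_of_le_one_right (hg x) (mulVec_mem_Icc hM hf x).2

lemma expect_mul_mulVec_le_right (hM : M ∈ doublyStochastic ℝ X) (hf : 0 ≤ f)
    (hg : ∀ x, g x ∈ Icc (0 : ℝ) 1) : 𝔼 x, g x * (M *ᵥ f) x ≤ 𝔼 x, f x := by
  rw [← expect_mulVec hM f]
  gcongr with x _
  exact mul_le_of_le_one_left (mulVec_nonneg hM hf x) (hg x).2

lemma expect_mul_mulVec_eq_compl [Nonempty X] (hM : M ∈ doublyStochastic ℝ X) :
    𝔼 x, g x * (M *ᵥ f) x =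
      𝔼 x, f x + 𝔼 x, g x - 1 + 𝔼 x, (1 - g) x * (M *ᵥ (1 - f)) x := by
  have hone : 𝔼 _x : X, (1 : ℝ) = 1 := Fintype.expect_const 1
  rw [← expect_mulVec hM f, ← hone, ← Finset.expect_add_distrib, ← Finset.expect_sub_distrib,
    ← Finset.expect_add_distrib]
  refine Finset.expect_congr rfl fun x _ => ?_
  rw [mulVec_one_sub hM, Pi.sub_apply, Pi.one_apply]
  ring

lemma mul_rpow_eq_exp_neg_boundExponent {ρ α β : ℝ} (hρ : ρ ∈ Icc (0 : ℝ) 1)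
    (hα : α ∈ Ioc (0 : ℝ) 1) (hβ : β ∈ Ioc (0 : ℝ) 1) (hβα : ρ * level β < level α)
    (hαβ : ρ * level α < level β) :
    β ^ ((level β - ρ * level α) / ((1 - ρ ^ 2) * level β)) *
        α ^ ((level α - ρ * level β) / ((1 - ρ ^ 2) * level α)) =
      exp (-boundExponent ρ (level α) (level β)) := by
  have hs : 0 < level α := (mul_nonneg hρ.1 (level_nonneg β)).trans_lt hβα
  have ht : 0 < level β := (mul_nonneg hρ.1 (level_nonneg α)).trans_lt hαβ
  have hρ_sq := one_sub_sq_pos hρ.1 (lt_one_of_mul_lt_of_mul_lt hs.le ht.le hβα hαβ)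
  have hlogα : log α = -(level α ^ 2 / 2) := by linarith [level_sq hα.1.le hα.2]
  have hlogβ : log β = -(level β ^ 2 / 2) := by linarith [level_sq hβ.1.le hβ.2]
  rw [boundExponent, if_neg hβα.not_ge, if_neg hαβ.not_ge, rpow_def_of_pos hα.1,
    rpow_def_of_pos hβ.1, ← Real.exp_add, hlogα, hlogβ]
  congr 1
  field_simp
  ring

/-- These exponents minimize `β ^ (1 / p) * α ^ (1 / q)` under the constraint
`(p - 1) * (q - 1) = ρ ^ 2`, where `s` and `t` are the levels of `α` and `β`. -/
lemma exists_hypercontractive_exponents {ρ s t : ℝ} (hρ : 0 ≤ ρ)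
    (hts : ρ * t < s) (hst : ρ * s < t) :
    ∃ p q : ℝ, 1 ≤ p ∧ 1 ≤ q ∧ (p - 1) * (q - 1) = ρ ^ 2 ∧
      1 / p = (t - ρ * s) / ((1 - ρ ^ 2) * t) ∧ 1 / q = (s - ρ * t) / ((1 - ρ ^ 2) * s) := by
  have hs' : 0 < s - ρ * t := sub_pos.2 hts
  have ht' : 0 < t - ρ * s := sub_pos.2 hst
  refine ⟨(1 - ρ ^ 2) * t / (t - ρ * s), (1 - ρ ^ 2) * s / (s - ρ * t), ?_, ?_, ?_,
    one_div_div _ _, one_div_div _ _⟩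
  · rw [one_le_div ht']
    linarith [mul_nonneg hρ hs'.le]
  · rw [one_le_div hs']
    linarith [mul_nonneg hρ ht'.le]
  · field_simp
    ring

lemma expect_mul_mulVec_le_expansionBound {ρ : ℝ} (hρ : ρ ∈ Icc (0 : ℝ) 1)
    (hM : M ∈ doublyStochastic ℝ X)
    (hyper : ∀ p q : ℝ, 1 ≤ p → 1 ≤ q → (p - 1) * (q - 1) = ρ ^ 2 → IsHypercontractive p q M)
    (hf : ∀ x, f x ∈ Icc (0 : ℝ) 1) (hg : ∀ x, g x ∈ Icc (0 : ℝ) 1) (hf_pos : 0 < 𝔼 x, f x) :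
    𝔼 x, g x * (M *ᵥ f) x ≤ expansionBound ρ (𝔼 x, f x) (𝔼 x, g x) := by
  have hle_g := expect_mul_mulVec_le_left hM hf fun x => (hg x).1
  have hle_f := expect_mul_mulVec_le_right hM (fun x => (hf x).1) hg
  rcases le_or_gt (𝔼 x, g x) 0 with hg0 | hg_pos
  · rw [expansionBound_of_nonpos hg0]
    exact hle_g.trans hg0
  have hα : 𝔼 x, f x ∈ Ioc (0 : ℝ) 1 := ⟨hf_pos, (expect_mem_Icc hf).2⟩
  have hβ : 𝔼 x, g x ∈ Ioc (0 : ℝ) 1 := ⟨hg_pos, (expect_mem_Icc hg).2⟩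
  rw [expansionBound_of_pos hg_pos]
  by_cases hst : level (𝔼 x, f x) ≤ ρ * level (𝔼 x, g x)
  · rwa [boundExponent, if_pos hst, exp_neg_level_sq hβ.1 hβ.2]
  by_cases hts : level (𝔼 x, g x) ≤ ρ * level (𝔼 x, f x)
  · rwa [boundExponent, if_neg hst, if_pos hts, exp_neg_level_sq hα.1 hα.2]
  push Not at hst hts
  obtain ⟨p, q, hp, hq, hpq, hp_inv, hq_inv⟩ := exists_hypercontractive_exponents hρ.1 hst hts
  calc 𝔼 x, g x * (M *ᵥ f) x ≤ lpMean p g * lpMean q f :=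
        hyper p q hp hq hpq g f (fun x => (hg x).1) fun x => (hf x).1
    _ ≤ (𝔼 x, g x) ^ (1 / p) * (𝔼 x, f x) ^ (1 / q) :=
        mul_le_mul (lpMean_le_expect_rpow hp hg) (lpMean_le_expect_rpow hq hf)
          (lpMean_nonneg q fun x => (hf x).1) (rpow_nonneg hβ.1.le _)
    _ = exp (-boundExponent ρ (level (𝔼 x, f x)) (level (𝔼 x, g x))) := by
        rw [hp_inv, hq_inv, mul_rpow_eq_exp_neg_boundExponent hρ hα hβ hst hts]

lemma expect_mul_mulVec_le_noiseBound [Nonempty X] {ρ : ℝ} (hρ : ρ ∈ Icc (0 : ℝ) 1)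
    (hM : M ∈ doublyStochastic ℝ X)
    (hyper : ∀ p q : ℝ, 1 ≤ p → 1 ≤ q → (p - 1) * (q - 1) = ρ ^ 2 → IsHypercontractive p q M)
    (hf : ∀ x, f x ∈ Icc (0 : ℝ) 1) (hg : ∀ x, g x ∈ Icc (0 : ℝ) 1)
    (hα : 𝔼 x, f x ∈ Ioo (0 : ℝ) 1) :
    𝔼 x, g x * (M *ᵥ f) x ≤ noiseBound ρ (𝔼 x, f x) (𝔼 x, g x) := by
  unfold noiseBound
  split_ifs
  · exact expect_mul_mulVec_le_expansionBound hρ hM hyper hf hg hα.1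
  · have hcompl : ∀ h : X → ℝ, 𝔼 x, (1 - h) x = 1 - 𝔼 x, h x := fun h => by
      simp only [Pi.sub_apply, Pi.one_apply, Finset.expect_sub_distrib, Fintype.expect_const]
    rw [expect_mul_mulVec_eq_compl hM, ← hcompl f, ← hcompl g]
    gcongr
    exact expect_mul_mulVec_le_expansionBound hρ hM hyper
      (fun x => Icc.mem_iff_one_sub_mem.1 (hf x)) (fun x => Icc.mem_iff_one_sub_mem.1 (hg x))
      (by rw [hcompl]; linarith [hα.2])

lemma expect_mul_mulVec_le_integral_theta [Nonempty X] {ρ : ℝ} (hρ : ρ ∈ Icc (0 : ℝ) 1)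
    (hM : M ∈ doublyStochastic ℝ X)
    (hyper : ∀ p q : ℝ, 1 ≤ p → 1 ≤ q → (p - 1) * (q - 1) = ρ ^ 2 → IsHypercontractive p q M)
    (hf : ∀ x, f x ∈ Icc (0 : ℝ) 1) (hg : ∀ x, g x ∈ Icc (0 : ℝ) 1) :
    𝔼 x, g x * (M *ᵥ f) x ≤ ∫ u in (0 : ℝ)..𝔼 x, g x, theta ρ (𝔼 x, f x) u := by
  have hα := expect_mem_Icc hf
  rcases hα.1.eq_or_lt with hα0 | hα0
  · simpa [theta, ← hα0] using expect_mul_mulVec_le_right hM (fun x => (hf x).1) hg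
  rcases hα.2.eq_or_lt with hα1 | hα1
  · simpa [theta, hα1, not_le.2 (one_pos (α := ℝ))]
      using expect_mul_mulVec_le_left hM hf fun x => (hg x).1
  rw [integral_theta_eq_noiseBound hρ ⟨hα0, hα1⟩ (expect_mem_Icc hg)]
  exact expect_mul_mulVec_le_noiseBound hρ hM hyper hf hg ⟨hα0, hα1⟩

end SmallSetExpansion

section Majorization

variable {X : Type*} [Fintype X]

/-- A finite form of majorization: the averages of `g` over a finite type `X` with its uniform
probability measure are controlled by the integrals of `h` over initial segments of `[0, 1]`.
The function `h` need not be decreasing. -/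
structure IsMajorizedBy (g : X → ℝ) (h : ℝ → ℝ) : Prop where
  sum_div_card_le : ∀ B : Finset X,
    (∑ x ∈ B, g x) / Fintype.card X ≤ ∫ u in (0 : ℝ)..B.card / Fintype.card X, h u
  expect_eq : 𝔼 x, g x = ∫ u in (0 : ℝ)..1, h u

namespace IsMajorizedBy

lemma sum_mul {ι : Type*} [Fintype ι] {c : ι → ℝ} (hc : 0 ≤ c) {g : ι → X → ℝ} {h : ι → ℝ → ℝ}
    (hgh : ∀ i, IsMajorizedBy (g i) (h i))
    (hint : ∀ i a b, IntervalIntegrable (h i) volume a b) :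
    IsMajorizedBy (fun x => ∑ i, c i * g i x) (fun u => ∑ i, c i * h i u) := by
  have hsum : ∀ r, ∫ u in (0 : ℝ)..r, ∑ i, c i * h i u = ∑ i, c i * ∫ u in (0 : ℝ)..r, h i u :=
    fun r => by
      rw [intervalIntegral.integral_finsetSum fun i _ => (hint i _ _).const_mul _]
      simp only [intervalIntegral.integral_const_mul]
  constructor
  · intro B
    rw [hsum, Finset.sum_comm, Finset.sum_div]
    gcongr with i _
    rw [← Finset.mul_sum, mul_div_assoc]
    exact mul_le_mul_of_nonneg_left ((hgh i).sum_div_card_le B) (hc i)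
  · rw [hsum, Finset.expect_sum_comm]
    simp only [← Finset.mul_expect, (hgh _).expect_eq]

lemma mul_add_const [Nonempty X] {g : X → ℝ} {h : ℝ → ℝ} (hgh : IsMajorizedBy g h)
    (hint : ∀ a b, IntervalIntegrable h volume a b) {c : ℝ} (hc : 0 ≤ c) (d : ℝ) :
    IsMajorizedBy (fun x => c * g x + d) (fun u => c * h u + d) := by
  have haffine : ∀ r, ∫ u in (0 : ℝ)..r, (c * h u + d) = c * (∫ u in (0 : ℝ)..r, h u) + r * d :=
    fun r => by
      rw [intervalIntegral.integral_add ((hint _ _).const_mul _) intervalIntegrable_const,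
        intervalIntegral.integral_const_mul, intervalIntegral.integral_const, sub_zero,
        smul_eq_mul]
  constructor
  · intro B
    rw [haffine, Finset.sum_add_distrib, ← Finset.mul_sum, Finset.sum_const, nsmul_eq_mul,
      add_div, mul_div_assoc, mul_div_right_comm]
    gcongr
    exact hgh.sum_div_card_le B
  · rw [haffine, Finset.expect_add_distrib, ← Finset.mul_expect, Fintype.expect_const,
      hgh.expect_eq, one_mul]

end IsMajorizedBy

lemma exists_antitoneOn_enumeration [Nonempty X] (g : X → ℝ) :
    ∃ e : ℕ → X, BijOn e (Iio (Fintype.card X)) univ ∧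
      AntitoneOn (g ∘ e) (Iio (Fintype.card X)) := by
  set e₀ := (Fintype.equivFin X).symm
  set σ := (Tuple.sort fun i => -g (e₀ i)).trans e₀
  have hσ : Antitone (g ∘ σ) := fun i j hij =>
    neg_le_neg_iff.1 (Tuple.monotone_sort (fun i => -g (e₀ i)) hij)
  set e : ℕ → X := fun i => if h : i < Fintype.card X then σ ⟨i, h⟩ else Classical.arbitrary X
  have he : ∀ i (h : i < Fintype.card X), e i = σ ⟨i, h⟩ := fun i h => dif_pos h
  refine ⟨e, ⟨mapsTo_univ _ _, fun i hi j hj hij => ?_, fun x _ => ?_⟩, fun i hi j hj hij => ?_⟩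
  · rw [he i hi, he j hj] at hij
    exact congrArg Fin.val (σ.injective hij)
  · exact ⟨σ.symm x, (σ.symm x).2, by rw [he _ (σ.symm x).2]; exact σ.apply_symm_apply x⟩
  · simp only [Function.comp_apply, he i hi, he j hj]
    exact hσ hij

lemma expect_eq_sum_range_div {e : ℕ → X} (he : BijOn e (Iio (Fintype.card X)) univ) (F : X → ℝ) :
    𝔼 x, F x = ∑ i ∈ Finset.range (Fintype.card X), F (e i) / Fintype.card X := by
  rw [Fintype.expect_eq_sum_div_card, Finset.sum_div]
  refine (Finset.sum_nbij e (fun _ _ => Finset.mem_univ _) ?_ ?_ fun _ _ => rfl).symm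
  · simpa using he.injOn
  · simpa using he.surjOn

lemma IsMajorizedBy.sum_range_div_le {g : X → ℝ} {h : ℝ → ℝ} (hgh : IsMajorizedBy g h)
    {e : ℕ → X} (he : InjOn e (Iio (Fintype.card X))) {j : ℕ} (hj : j ≤ Fintype.card X) :
    ∑ i ∈ Finset.range j, g (e i) / Fintype.card X ≤
      ∫ u in (0 : ℝ)..j / Fintype.card X, h u := by
  classical
  have hinj : InjOn e (Finset.range j) := he.mono (by simpa using hj)
  have := hgh.sum_div_card_le ((Finset.range j).image e)
  rwa [Finset.sum_image hinj, Finset.card_image_of_injOn hinj, Finset.card_range,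
    Finset.sum_div] at this

lemma sum_integral_div {h : ℝ → ℝ} (hint : ∀ v w, IntervalIntegrable h volume v w) (N j : ℕ) :
    ∑ i ∈ Finset.range j, ∫ u in (i / N : ℝ)..((i + 1 : ℕ) / N : ℝ), h u =
      ∫ u in (0 : ℝ)..j / N, h u := by
  simpa using intervalIntegral.sum_integral_adjacent_intervals (a := fun i : ℕ => (i / N : ℝ))
    (n := j) (μ := volume) fun i _ => hint _ _

lemma sum_mul_nonneg_of_antitoneOn {N : ℕ} {c d : ℕ → ℝ} (hc : AntitoneOn c (Iio N))
    (hd : ∀ j < N, 0 ≤ ∑ i ∈ Finset.range j, d i) (hd_total : ∑ i ∈ Finset.range N, d i = 0) :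
    0 ≤ ∑ i ∈ Finset.range N, c i * d i := by
  simp only [← smul_eq_mul (a := c _)]
  rw [Finset.sum_range_by_parts, hd_total, smul_zero, zero_sub, neg_nonneg]
  refine Finset.sum_nonpos fun i hi => mul_nonpos_of_nonpos_of_nonneg ?_ ?_
  · have hi := Finset.mem_range.1 hi
    exact sub_nonpos.2 (hc (mem_Iio.2 (by omega)) (mem_Iio.2 (by omega)) i.le_succ)
  · exact hd _ (by have := Finset.mem_range.1 hi; omega)

section Convex

variable {Φ h : ℝ → ℝ} {a b : ℝ}

lemma add_rightDeriv_mul_sub_le {S : Set ℝ} (hΦ : ConvexOn ℝ S Φ) {y z : ℝ}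
    (hy : y ∈ interior S) (hz : z ∈ S) : Φ y + derivWithin Φ (Ioi y) y * (z - y) ≤ Φ z := by
  rcases lt_trichotomy y z with hyz | rfl | hzy
  · have hslope := hΦ.rightDeriv_le_slope_of_mem_interior hy hz hyz
    rw [slope_def_field, le_div_iff₀ (by linarith)] at hslope
    linarith
  · simp
  · have hslope := (hΦ.slope_le_leftDeriv_of_mem_interior hz hy hzy).trans
      (hΦ.leftDeriv_le_rightDeriv_of_mem_interior hy)
    rw [slope_def_field, div_le_iff₀ (by linarith)] at hslope
    linarith

lemma intervalIntegrable_comp_of_mem_Icc (hΦ : ContinuousOn Φ (Icc a b))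
    (hm : Measurable h) (hh : ∀ u, h u ∈ Icc a b) (v w : ℝ) :
    IntervalIntegrable (fun u => Φ (h u)) volume v w := by
  have hab : a ≤ b := (hh 0).1.trans (hh 0).2
  obtain ⟨C, hC⟩ := isCompact_Icc.exists_bound_of_continuousOn hΦ
  have hext : (fun u => Φ (h u)) = IccExtend hab ((Icc a b).domRestrict Φ) ∘ h := by
    ext u
    rw [Function.comp, IccExtend_of_mem _ _ (hh u)]
    rfl
  have hmeas : Measurable fun u => Φ (h u) := by
    rw [hext]
    exact (continuousOn_iff_continuous_domRestrict.1 hΦ).Icc_extend'.measurable.comp hm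
  exact (intervalIntegrable_const (c := C)).mono_fun hmeas.aestronglyMeasurable
    (.of_forall fun u => (hC _ (hh u)).trans (le_abs_self C))

lemma intervalIntegrable_of_mem_Icc (hm : Measurable h) (hh : ∀ u, h u ∈ Icc a b) (v w : ℝ) :
    IntervalIntegrable h volume v w :=
  intervalIntegrable_comp_of_mem_Icc (Φ := id) continuousOn_id hm hh v w

lemma mul_add_rightDeriv_mul_le_integral (hΦc : ContinuousOn Φ (Icc a b))
    (hΦ : ConvexOn ℝ (Icc a b) Φ) (hm : Measurable h) (hh : ∀ u, h u ∈ Icc a b)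
    {y v w : ℝ} (hy : y ∈ Ioo a b) (hvw : v ≤ w) :
    (w - v) * Φ y + derivWithin Φ (Ioi y) y * ((∫ u in v..w, h u) - (w - v) * y) ≤
      ∫ u in v..w, Φ (h u) := by
  have hint := intervalIntegrable_of_mem_Icc hm hh v w
  have hint_sub := (hint.sub (intervalIntegrable_const (c := y))).const_mul
    (derivWithin Φ (Ioi y) y)
  calc (w - v) * Φ y + derivWithin Φ (Ioi y) y * ((∫ u in v..w, h u) - (w - v) * y)
      = ∫ u in v..w, (Φ y + derivWithin Φ (Ioi y) y * (h u - y)) := by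
        rw [intervalIntegral.integral_add intervalIntegrable_const hint_sub,
          intervalIntegral.integral_const_mul,
          intervalIntegral.integral_sub hint intervalIntegrable_const]
        simp only [intervalIntegral.integral_const, smul_eq_mul]
    _ ≤ ∫ u in v..w, Φ (h u) :=
        intervalIntegral.integral_mono_on hvw (intervalIntegrable_const.add hint_sub)
          (intervalIntegrable_comp_of_mem_Icc hΦc hm hh v w) fun u _ =>
          add_rightDeriv_mul_sub_le hΦ (by rwa [interior_Icc]) (hh u)

end Convex

namespace IsMajorizedBy

variable [Nonempty X] {Φ h : ℝ → ℝ} {a b : ℝ} {g : X → ℝ}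

lemma expect_le_integral_of_mem_Ioo (hgh : IsMajorizedBy g h)
    (hΦc : ContinuousOn Φ (Icc a b)) (hΦ : ConvexOn ℝ (Icc a b) Φ) (hg : ∀ x, g x ∈ Ioo a b)
    (hm : Measurable h) (hh : ∀ u, h u ∈ Icc a b) :
    𝔼 x, Φ (g x) ≤ ∫ u in (0 : ℝ)..1, Φ (h u) := by
  obtain ⟨e, he, hge⟩ := exists_antitoneOn_enumeration g
  set N := Fintype.card X
  have hN : (N : ℝ) ≠ 0 := Nat.cast_ne_zero.2 Fintype.card_ne_zero
  set c : ℕ → ℝ := fun i => derivWithin Φ (Ioi (g (e i))) (g (e i))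
  set d : ℕ → ℝ := fun i => (∫ u in (i / N : ℝ)..((i + 1 : ℕ) / N : ℝ), h u) - g (e i) / N with hd
  have hc : AntitoneOn c (Iio N) := fun i hi j hj hij =>
    hΦ.monotoneOn_rightDeriv (by simpa using hg (e j)) (by simpa using hg (e i)) (hge hi hj hij)
  have sum_d : ∀ j, ∑ i ∈ Finset.range j, d i =
      (∫ u in (0 : ℝ)..j / N, h u) - ∑ i ∈ Finset.range j, g (e i) / N := fun j => by
    rw [hd, Finset.sum_sub_distrib, sum_integral_div (intervalIntegrable_of_mem_Icc hm hh)]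
  have sum_d_nonneg : ∀ j < N, 0 ≤ ∑ i ∈ Finset.range j, d i := fun j hj => by
    rw [sum_d, sub_nonneg]
    exact hgh.sum_range_div_le he.injOn hj.le
  have sum_d_eq_zero : ∑ i ∈ Finset.range N, d i = 0 := by
    rw [sum_d, div_self hN, ← expect_eq_sum_range_div he, hgh.expect_eq, sub_self]
  have cell_le : ∀ i : ℕ, Φ (g (e i)) / N + c i * d i ≤
      ∫ u in (i / N : ℝ)..((i + 1 : ℕ) / N : ℝ), Φ (h u) := fun i => by
    have hlen : ((i + 1 : ℕ) / N - i / N : ℝ) = (N : ℝ)⁻¹ := by push_cast; ring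
    have := mul_add_rightDeriv_mul_le_integral hΦc hΦ hm hh (hg (e i))
      (v := i / N) (w := (i + 1 : ℕ) / N) (by gcongr; simp)
    rwa [hlen, inv_mul_eq_div, inv_mul_eq_div] at this
  calc 𝔼 x, Φ (g x) ≤ ∑ i ∈ Finset.range N, (Φ (g (e i)) / N + c i * d i) := by
        rw [expect_eq_sum_range_div he, Finset.sum_add_distrib]
        linarith [sum_mul_nonneg_of_antitoneOn hc sum_d_nonneg sum_d_eq_zero]
    _ ≤ ∑ i ∈ Finset.range N, ∫ u in (i / N : ℝ)..((i + 1 : ℕ) / N : ℝ), Φ (h u) :=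
        Finset.sum_le_sum fun i _ => cell_le i
    _ = ∫ u in (0 : ℝ)..1, Φ (h u) := by
        rw [sum_integral_div (intervalIntegrable_comp_of_mem_Icc hΦc hm hh), div_self hN]

lemma expect_shrink_le (hgh : IsMajorizedBy g h) (hΦc : ContinuousOn Φ (Icc a b))
    (hΦ : ConvexOn ℝ (Icc a b) Φ) (hg : ∀ x, g x ∈ Icc a b) (hm : Measurable h)
    (hh : ∀ u, h u ∈ Icc a b) {m δ : ℝ} (hm_mem : m ∈ Ioo a b) (hδ : δ ∈ Ioo (0 : ℝ) 1) :
    𝔼 x, Φ ((1 - δ) * g x + δ * m) ≤ (1 - δ) * (∫ u in (0 : ℝ)..1, Φ (h u)) + δ * Φ m := by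
  have hδ₀ : 0 ≤ 1 - δ := by linarith [hδ.2]
  have shrink : ∀ {z}, z ∈ Icc a b → (1 - δ) * z + δ * m ∈ Ioo a b := fun {z} hz => by
    have := (convex_Icc a b).combo_self_interior_mem_interior hz (by rwa [interior_Icc]) hδ₀ hδ.1
      (sub_add_cancel 1 δ)
    rwa [interior_Icc] at this
  have hm' : Measurable fun u => (1 - δ) * h u + δ * m := by fun_prop
  have hh' : ∀ u, (1 - δ) * h u + δ * m ∈ Icc a b := fun u => Ioo_subset_Icc_self (shrink (hh u))
  have hint := (intervalIntegrable_comp_of_mem_Icc hΦc hm hh 0 1).const_mul (1 - δ)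
  calc 𝔼 x, Φ ((1 - δ) * g x + δ * m) ≤ ∫ u in (0 : ℝ)..1, Φ ((1 - δ) * h u + δ * m) :=
        (hgh.mul_add_const (intervalIntegrable_of_mem_Icc hm hh) hδ₀
          (δ * m)).expect_le_integral_of_mem_Ioo hΦc hΦ (fun x => shrink (hg x)) hm' hh'
    _ ≤ ∫ u in (0 : ℝ)..1, ((1 - δ) * Φ (h u) + δ * Φ m) :=
        intervalIntegral.integral_mono_on zero_le_one
          (intervalIntegrable_comp_of_mem_Icc hΦc hm' hh' 0 1)
          (hint.add intervalIntegrable_const) fun u _ =>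
          hΦ.2 (hh u) (Ioo_subset_Icc_self hm_mem) hδ₀ hδ.1.le (sub_add_cancel 1 δ)
    _ = (1 - δ) * (∫ u in (0 : ℝ)..1, Φ (h u)) + δ * Φ m := by
        rw [intervalIntegral.integral_add hint intervalIntegrable_const,
          intervalIntegral.integral_const_mul, intervalIntegral.integral_const]
        simp

/-- The Hardy-Littlewood-Pólya inequality. At the ends of `[a, b]` the slopes of `Φ` may be
infinite, so both functions are first contracted towards an interior point. -/
theorem expect_le_integral (hgh : IsMajorizedBy g h) (hab : a < b)
    (hΦc : ContinuousOn Φ (Icc a b)) (hΦ : ConvexOn ℝ (Icc a b) Φ) (hg : ∀ x, g x ∈ Icc a b)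
    (hm : Measurable h) (hh : ∀ u, h u ∈ Icc a b) :
    𝔼 x, Φ (g x) ≤ ∫ u in (0 : ℝ)..1, Φ (h u) := by
  obtain ⟨m, hm_mem⟩ := nonempty_Ioo.2 hab
  have tendsto_of_continuous : ∀ {k : ℝ → ℝ}, Continuous k →
      Filter.Tendsto k (nhdsWithin 0 (Ioi 0)) (nhds (k 0)) := fun hk =>
    (hk.tendsto 0).mono_left nhdsWithin_le_nhds
  have hδ : ∀ᶠ δ in nhdsWithin (0 : ℝ) (Ioi 0), δ ∈ Ioo (0 : ℝ) 1 := Ioo_mem_nhdsGT one_pos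
  have tendsto_left : Filter.Tendsto (fun δ : ℝ => 𝔼 x, Φ ((1 - δ) * g x + δ * m))
      (nhdsWithin 0 (Ioi 0)) (nhds (𝔼 x, Φ (g x))) := by
    simp only [Fintype.expect_eq_sum_div_card]
    refine (tendsto_finsetSum _ fun x _ => (hΦc (g x) (hg x)).tendsto.comp
      (tendsto_nhdsWithin_iff.2 ⟨?_, ?_⟩)).div_const _
    · simpa using tendsto_of_continuous (k := fun δ => (1 - δ) * g x + δ * m) (by fun_prop)
    · filter_upwards [hδ] with δ hδ
      exact convex_Icc a b (hg x) (Ioo_subset_Icc_self hm_mem) (by linarith [hδ.2]) hδ.1.le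
        (sub_add_cancel 1 δ)
  have tendsto_right := tendsto_of_continuous
    (k := fun δ => (1 - δ) * (∫ u in (0 : ℝ)..1, Φ (h u)) + δ * Φ m) (by fun_prop)
  rw [sub_zero, one_mul, zero_mul, add_zero] at tendsto_right
  exact le_of_tendsto_of_tendsto tendsto_left tendsto_right
    (hδ.mono fun δ hδ => hgh.expect_shrink_le hΦc hΦ hg hm hh hm_mem hδ)

end IsMajorizedBy

end Majorization

lemma isMajorizedBy_mulVec {X : Type*} [Fintype X] [DecidableEq X] [Nonempty X] {ρ : ℝ}
    (hρ : ρ ∈ Icc (0 : ℝ) 1) {M : Matrix X X ℝ} (hM : M ∈ doublyStochastic ℝ X)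
    (hyper : ∀ p q : ℝ, 1 ≤ p → 1 ≤ q → (p - 1) * (q - 1) = ρ ^ 2 → IsHypercontractive p q M)
    {f : X → ℝ} (hf : ∀ x, f x ∈ Icc (0 : ℝ) 1) :
    IsMajorizedBy (M *ᵥ f) (theta ρ (𝔼 x, f x)) where
  sum_div_card_le B := by
    have := expect_mul_mulVec_le_integral_theta hρ hM hyper hf
      (g := fun x => if x ∈ B then 1 else 0) fun x => by split_ifs <;> simp
    simpa [Fintype.expect_eq_sum_div_card] using this
  expect_eq := by rw [expect_mulVec hM, integral_theta hρ (expect_mem_Icc hf)]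

section Subcube

lemma pow_mul_pow_hammingDist_eq_cubeNoise (ρ : ℝ) {ι : Type} [Fintype ι] (a b : Cube ι) :
    ((1 + ρ) / 2) ^ (Fintype.card ι - hammingDist b a) * ((1 - ρ) / 2) ^ hammingDist b a =
      cubeNoise ρ ι a b := by
  have hcard : (Finset.univ.filter fun i => b i = a i).card + hammingDist b a = Fintype.card ι := by
    rw [← Finset.card_univ]
    exact Finset.card_filter_add_card_filter_not _
  simp only [cubeNoise, bitNoise, Matrix.of_apply]
  rw [Finset.prod_ite, Finset.prod_const, Finset.prod_const, ← hcard, Nat.add_sub_cancel]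
  rfl

lemma mean_eq_expect {n : ℕ} (g : Cube (Fin n) → ℝ) : mean g = 𝔼 x, g x := by
  simp [mean, Fintype.expect_eq_sum_div_card]

variable {n : ℕ} (S : Finset (Fin n))

/-- The splitting of a point `x` of the cube into `x_S` and its remaining coordinates, so that the
points with a given first component form the subcube `{x_S = a}`. -/
def cubeSplit : Cube (Fin n) ≃ Cube S × Cube {i // i ∉ S} :=
  Equiv.piEquivPiSubtypeProd (· ∈ S) fun _ => ℤˣ

/-- The restriction of `f` to the subcube `{x_S = a}`, as a function of the free coordinates. -/
def subcubeRestrict (f : Cube (Fin n) → ℝ) (a : Cube S) (x : Cube {i // i ∉ S}) : ℝ :=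
  f ((cubeSplit S).symm (a, x))

lemma mean_eq_expect_subcubeRestrict (f : Cube (Fin n) → ℝ) :
    mean f = 𝔼 a, 𝔼 x, subcubeRestrict S f a x := by
  rw [mean_eq_expect, ← Finset.expect_product' Finset.univ Finset.univ (subcubeRestrict S f),
    Finset.univ_product_univ]
  exact (Fintype.expect_equiv (cubeSplit S).symm _ _ fun _ => rfl).symm

lemma cubeSplit_symm_apply_mem (a : Cube S) (x : Cube {i // i ∉ S}) (i : S) :
    (cubeSplit S).symm (a, x) i = a i :=
  congrFun (congrArg Prod.fst ((cubeSplit S).apply_symm_apply (a, x))) i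

lemma two_pow_mul_subcubeMass (f : Cube (Fin n) → ℝ) (b : Cube S) :
    2 ^ S.card * subcubeMass f S b = 𝔼 x, subcubeRestrict S f b x := by
  have hrestrict : ∀ a : Cube S,
      𝔼 x, subcubeRestrict S (fun x => if ∀ i : S, x i = b i then f x else 0) a x =
        if a = b then 𝔼 x, subcubeRestrict S f b x else 0 := fun a => by
    simp only [subcubeRestrict, cubeSplit_symm_apply_mem, ← funext_iff]
    split_ifs with hab
    · rw [hab]
    · exact Finset.expect_const_zero _
  rw [subcubeMass, mean_eq_expect_subcubeRestrict S]
  simp only [hrestrict]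
  simp [Fintype.expect_eq_sum_div_card (ι := Cube S), mul_div_cancel₀]

lemma cubeNoise_eq_submatrix_kronecker (ρ : ℝ) :
    cubeNoise ρ (Fin n) =
      (cubeNoise ρ S ⊗ₖ cubeNoise ρ {i // i ∉ S}).submatrix (cubeSplit S) (cubeSplit S) := by
  ext x y
  simp only [cubeNoise, Matrix.of_apply, submatrix_apply, Matrix.kroneckerMap_apply]
  rw [← Fintype.prod_subtype_mul_prod_subtype (· ∈ S)]
  congr 1
  convert! rfl

lemma subcubeRestrict_noiseOp (ρ : ℝ) (f : Cube (Fin n) → ℝ) (a : Cube S)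
    (x : Cube {i // i ∉ S}) :
    subcubeRestrict S (noiseOp ρ f) a x =
      ∑ b, cubeNoise ρ S a b * (cubeNoise ρ {i // i ∉ S} *ᵥ subcubeRestrict S f b) x := by
  change (cubeNoise ρ (Fin n) *ᵥ f) ((cubeSplit S).symm (a, x)) = _
  rw [cubeNoise_eq_submatrix_kronecker S, submatrix_mulVec_equiv,
    Function.comp_apply, Equiv.apply_symm_apply, kronecker_mulVec_apply]
  rfl

theorem mean_noiseOp_le_Gamma {Φ : ℝ → ℝ} (hΦc : ContinuousOn Φ (Icc 0 1))
    (hΦ : ConvexOn ℝ (Icc 0 1) Φ) {ρ : ℝ} (hρ : ρ ∈ Icc (0 : ℝ) 1) {f : Cube (Fin n) → ℝ}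
    (hf : ∀ x, f x ∈ Icc (0 : ℝ) 1) :
    mean (fun x => Φ (noiseOp ρ f x)) ≤
      Gamma Φ ρ (fun a : Cube S => 2 ^ S.card * subcubeMass f S a) := by
  have hcube : cubeNoise ρ S ∈ doublyStochastic ℝ (Cube S) := cubeNoise_mem_doublyStochastic hρ
  have hcompl := cubeNoise_mem_doublyStochastic (ι := {i // i ∉ S}) hρ
  have majorized : ∀ b, IsMajorizedBy (cubeNoise ρ {i // i ∉ S} *ᵥ subcubeRestrict S f b)
      (theta ρ (𝔼 x, subcubeRestrict S f b x)) := fun b =>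
    isMajorizedBy_mulVec hρ hcompl
      (fun _ _ hp hq hpq => isHypercontractive_cubeNoise hp hq hρ hpq) fun _ => hf _
  rw [mean_eq_expect_subcubeRestrict S, Fintype.expect_eq_sum_div_card]
  simp only [Gamma, two_pow_mul_subcubeMass, pow_mul_pow_hammingDist_eq_cubeNoise]
  rw [Fintype.card_fun, Fintype.card_units_int, Nat.cast_pow, Nat.cast_ofNat]
  gcongr with a _
  calc 𝔼 x, Φ (subcubeRestrict S (noiseOp ρ f) a x)
      = 𝔼 x, Φ (∑ b, cubeNoise ρ S a b *
          (cubeNoise ρ {i // i ∉ S} *ᵥ subcubeRestrict S f b) x) := by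
        simp only [subcubeRestrict_noiseOp]
    _ ≤ ∫ u in (0 : ℝ)..1,
          Φ (∑ b, cubeNoise ρ S a b * theta ρ (𝔼 x, subcubeRestrict S f b x) u) :=
        (IsMajorizedBy.sum_mul (fun b => nonneg_of_mem_doublyStochastic hcube) majorized
          fun b => intervalIntegrable_theta hρ _).expect_le_integral one_pos hΦc hΦ
          (fun x => mulVec_mem_Icc hcube (fun b => mulVec_mem_Icc hcompl (fun _ => hf _) x) a)
          (Finset.measurable_fun_sum _ fun b _ => (measurable_theta ρ _).const_mul _)
          fun u => mulVec_mem_Icc hcube (fun b => theta_mem_Icc hρ _ u) a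

end Subcube

end

end NoiseStability

theorem mainTheorem10_general (Φ : ℝ → ℝ) (hΦc : ContinuousOn Φ (Set.Icc 0 1))
    (hΦ : ConvexOn ℝ (Set.Icc 0 1) Φ) (ρ : ℝ) (hρ : ρ ∈ Set.Icc (0 : ℝ) 1)
    (n k : ℕ) (hk : k ≤ n) (f : NoiseStability.Cube (Fin n) → ℝ)
    (hf : ∀ x, f x ∈ Set.Icc (0 : ℝ) 1) :
    NoiseStability.mean (fun x => Φ (NoiseStability.noiseOp ρ f x)) ≤
      (Finset.powersetCard k (Finset.univ : Finset (Fin n))).inf'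
        (Finset.powersetCard_nonempty.mpr (by simpa using hk))
        (fun S => NoiseStability.Gamma Φ ρ
          (fun a : NoiseStability.Cube S => 2 ^ k * NoiseStability.subcubeMass f S a)) := by
  refine Finset.le_inf' _ _ fun S hS => ?_
  obtain rfl := (Finset.mem_powersetCard.1 hS).2
  exact NoiseStability.mean_noiseOp_le_Gamma S hΦc hΦ hρ hf

theorem mainTheorem10 (Φ : ℝ → ℝ) (hΦc : ContinuousOn Φ (Set.Icc 0 1))
    (hΦ : ConvexOn ℝ (Set.Icc 0 1) Φ) (ρ : ℝ) (hρ : ρ ∈ Set.Icc (0 : ℝ) 1)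
    (n k : ℕ) (hk : k ≤ n) (f : NoiseStability.Cube (Fin n) → ℝ)
    (hf : NoiseStability.IsBoolean f) :
    NoiseStability.mean (fun x => Φ (NoiseStability.noiseOp ρ f x)) ≤
      (Finset.powersetCard k (Finset.univ : Finset (Fin n))).inf'
        (Finset.powersetCard_nonempty.mpr (by simpa using hk))
        (fun S => NoiseStability.Gamma Φ ρ
          (fun a : NoiseStability.Cube S => 2 ^ k * NoiseStability.subcubeMass f S a)) :=
  mainTheorem10_general Φ hΦc hΦ ρ hρ n k hk f fun x => by rcases hf x with h | h <;> simp [h]
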